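/- **Setting.** Let $M$ be a smooth, Hausdorff, second countable $n$-dimensional manifold. A *Finsler space-time* on $M$ consists of an open set $\mathcal C\subseteq TM\setminus\{0\}$, with non-empty fibres and closed under multiplication by positive scalars (for instance the whole slit tangent bundle $\mathcal C=TM\setminus\{0\}$), and a smooth function $L:\mathcal C\to\mathbb R$ with $L(x,ky)=k^2L(x,y)$ for $k>0$, whose vertical Hessian $g_{\mu\nu}=\partial^2L/\partial y^\mu\partial y^\nu$ has signature $(-,+,\dots,+)$ on $\mathcal C$. In local coordinates put $$S^\mu=g^{\mu\lambda}\Big(y^\nu\frac{\partial^2L}{\partial x^\nu\partial y^\lambda}-\frac{\partial L}{\partial x^\lambda}\Big),\quad N^\mu{}_\nu=\tfrac12\frac{\partial S^\mu}{\partial y^\nu},\quad \frac{\delta}{\delta x^\nu}=\frac{\partial}{\partial x^\nu}-N^\mu{}_\nu\frac{\partial}{\partial y^\mu}.$$ The geodesics are the curves with velocity in $\mathcal C$ and $\ddot x^\mu+S^\mu(x,\dot x)=0$; they are the world-lines of neutral point particles in a pure gravitational field. The Chern connection has coefficients $\Gamma^\mu_{\nu\rho}=\tfrac12 g^{\mu\lambda}\big(\tfrac{\delta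 g_{\lambda\rho}}{\delta x^\nu}+\tfrac{\delta g_{\lambda\nu}}{\delta x^\rho}-\tfrac{\delta g_{\nu\rho}}{\delta x^\lambda}\big)$, with $hh$-curvature $$R^\mu_{\nu\rho\sigma}=\frac{\delta\Gamma^\mu_{\nu\rho}}{\delta x^\sigma}-\frac{\delta\Gamma^\mu_{\sigma\rho}}{\delta x^\nu}+\Gamma^\mu_{\sigma\kappa}\Gamma^\kappa_{\nu\rho}-\Gamma^\mu_{\nu\kappa}\Gamma^\kappa_{\sigma\rho}$$ and $hv$-curvature $P^\mu_{\nu\rho\sigma}=\partial\Gamma^\mu_{\nu\rho}/\partial y^\sigma$. Here $\nabla P\neq0$ means that the covariant derivatives of $P$ in the horizontal directions $\delta/\delta x^\tau$ and in the vertical directions $\partial/\partial y^\tau$ do not all vanish identically on $\mathcal C$. **Equivalence principles.** The *weak equivalence principle* (WEP) holds if for every initial velocity in $\mathcal C$ there is a geodesic with that initial velocity, and any two geodesics on a common open interval with the same initial velocity coincide. *Einstein's equivalence principle* (EEP) holds if WEP holds and for every geodesic $X:I\to M$ ($I$ an open interval) and every $s_0\in I$ there is a smooth chart around $X(s_0)$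 in which 1. $\Gamma^\mu_{\nu\rho}(X(s),y)=0$ for all $s$ near $s_0$ and all $y\in\mathcal C_{X(s)}$; and 2. for every $\varepsilon>0$ there is $r>0$ such that the coordinate ball $B$ of radius $r$ about $X(s_0)$ lies in the chart, $|R^\mu_{\nu\rho\sigma}(x,y)|\,r^2\le\varepsilon$ for all $(x,y)\in\mathcal C$ with $x\in B$, and all geodesics satisfy $|\ddot c|\le\varepsilon|\dot c|^2$ (coordinate derivatives, Euclidean norm) at every parameter at which they lie in $B$; that is, near $X(s_0)$ the curvature is negligible and the world-lines of free particles are approximated by the straight lines of special relativity. *Schiff's conjecture* for the space-time is the implication WEP $\Rightarrow$ EEP. **Corollary.** For every Finsler space-time with $R=0$ and $\nabla P\neq0$, Schiff's conjecture does not hold: WEP holds, but EEP does not. -/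

import Mathlib

open scoped Manifold ContDiff Topology

noncomputable section

namespace FinslerGravity

/-! ### Tensor calculus of a Lagrangian in local coordinates

A Lagrangian in local coordinates is a function `ℓ x y` of position `x` and velocity `y`. -/

section LocalCalculus

variable {n : ℕ}

/-- Partial derivative with respect to the position coordinate `x^i`. -/
def dx (i : Fin n) (f : EuclideanSpace ℝ (Fin n) → EuclideanSpace ℝ (Fin n) → ℝ)
    (x y : EuclideanSpace ℝ (Fin n)) : ℝ :=
  fderiv ℝ (fun z => f z y) x (EuclideanSpace.single i 1)

/-- Partial derivative with respect to the velocity coordinate `y^i`. -/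
def dy (i : Fin n) (f : EuclideanSpace ℝ (Fin n) → EuclideanSpace ℝ (Fin n) → ℝ)
    (x y : EuclideanSpace ℝ (Fin n)) : ℝ :=
  fderiv ℝ (fun z => f x z) y (EuclideanSpace.single i 1)

variable (ℓ : EuclideanSpace ℝ (Fin n) → EuclideanSpace ℝ (Fin n) → ℝ)

/-- The vertical Hessian `g_{ij} = ∂²ℓ / ∂y^i ∂y^j`. -/
def vertHessian (x y : EuclideanSpace ℝ (Fin n)) : Matrix (Fin n) (Fin n) ℝ :=
  Matrix.of fun i j => dy i (dy j ℓ) x y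

/-- The coefficients `S^i = g^{il} (y^j ∂²ℓ/∂x^j∂y^l - ∂ℓ/∂x^l)` of the Finsler spray: where `g` is
invertible, the Euler-Lagrange equations of `ℓ` are `ẍ^i + S^i(x, ẋ) = 0`. -/
def sprayCoeff (i : Fin n) (x y : EuclideanSpace ℝ (Fin n)) : ℝ :=
  ∑ l, (vertHessian ℓ x y)⁻¹ i l * ((∑ j, y j * dx j (dy l ℓ) x y) - dx l ℓ x y)

/-- The non-linear connection `N^i_j = (1/2) ∂S^i/∂y^j`. -/
def nonlinConn (i j : Fin n) (x y : EuclideanSpace ℝ (Fin n)) : ℝ :=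
  1 / 2 * dy j (sprayCoeff ℓ i) x y

/-- The horizontal derivative `δ/δx^j = ∂/∂x^j - N^k_j ∂/∂y^k`. -/
def hderiv (j : Fin n) (f : EuclideanSpace ℝ (Fin n) → EuclideanSpace ℝ (Fin n) → ℝ)
    (x y : EuclideanSpace ℝ (Fin n)) : ℝ :=
  dx j f x y - ∑ k, nonlinConn ℓ k j x y * dy k f x y

/-- The coefficients of the Chern connection,
`Γ^i_{jk} = (1/2) g^{il} (δ_j g_{lk} + δ_k g_{lj} - δ_l g_{jk})`. -/
def chern (i j k : Fin n) (x y : EuclideanSpace ℝ (Fin n)) : ℝ :=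
  1 / 2 * ∑ l, (vertHessian ℓ x y)⁻¹ i l *
    (hderiv ℓ j (fun u v => vertHessian ℓ u v l k) x y
      + hderiv ℓ k (fun u v => vertHessian ℓ u v l j) x y
      - hderiv ℓ l (fun u v => vertHessian ℓ u v j k) x y)

/-- The `hh`-curvature (Riemann type curvature) of the Chern connection,
`R^μ_{νρσ} = δ_σ Γ^μ_{νρ} - δ_ν Γ^μ_{σρ} + Γ^μ_{σκ} Γ^κ_{νρ} - Γ^μ_{νκ} Γ^κ_{σρ}`. -/
def curvR (μ ν ρ σ : Fin n) (x y : EuclideanSpace ℝ (Fin n)) : ℝ :=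
  hderiv ℓ σ (chern ℓ μ ν ρ) x y - hderiv ℓ ν (chern ℓ μ σ ρ) x y
    + ∑ κ, (chern ℓ μ σ κ x y * chern ℓ κ ν ρ x y - chern ℓ μ ν κ x y * chern ℓ κ σ ρ x y)

/-- The `hv`-curvature `P^μ_{νρσ} = ∂Γ^μ_{νρ}/∂y^σ` of the Chern connection. -/
def curvP (μ ν ρ σ : Fin n) (x y : EuclideanSpace ℝ (Fin n)) : ℝ :=
  dy σ (chern ℓ μ ν ρ) x y

/-- The components of the horizontal covariant derivative of `P` in the direction `δ/δx^τ`. -/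
def hcovP (τ μ ν ρ σ : Fin n) (x y : EuclideanSpace ℝ (Fin n)) : ℝ :=
  hderiv ℓ τ (curvP ℓ μ ν ρ σ) x y
    + ∑ κ, (chern ℓ μ τ κ x y * curvP ℓ κ ν ρ σ x y
        - chern ℓ κ τ ν x y * curvP ℓ μ κ ρ σ x y
        - chern ℓ κ τ ρ x y * curvP ℓ μ ν κ σ x y
        - chern ℓ κ τ σ x y * curvP ℓ μ ν ρ κ x y)

/-- The components of the vertical covariant derivative of `P` in the direction `∂/∂y^τ` (the Chern
connection has no vertical connection coefficients). -/
def vcovP (τ μ ν ρ σ : Fin n) (x y : EuclideanSpace ℝ (Fin n)) : ℝ :=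
  dy τ (curvP ℓ μ ν ρ σ) x y

end LocalCalculus

/-- A matrix of Lorentzian signature `(-, +, …, +)`: it is congruent to `diag(1, …, -1, …, 1)` with
exactly one entry `-1`. -/
def IsLorentzian {n : ℕ} (g : Matrix (Fin n) (Fin n) ℝ) : Prop :=
  ∃ (A : Matrix (Fin n) (Fin n) ℝ) (i₀ : Fin n), IsUnit A.det ∧
    A.transpose * g * A = Matrix.diagonal (fun i => if i = i₀ then (-1 : ℝ) else 1)

/-! ### Finsler space-times -/

section Manifolds

variable {n : ℕ} {M : Type*} [TopologicalSpace M] [ChartedSpace (EuclideanSpace ℝ (Fin n)) M]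

/-- The tangent vector at the point with coordinates `x` whose components in the chart `e` are
`y`. -/
def chartVec (e : OpenPartialHomeomorph M (EuclideanSpace ℝ (Fin n)))
    (x y : EuclideanSpace ℝ (Fin n)) : TangentBundle (𝓡 n) M :=
  ⟨e.symm x, mfderiv (𝓡 n) (𝓡 n) e.symm x y⟩

/-- The velocity of a curve at parameter `t`, as a point of the tangent bundle. -/
def velocity (c : ℝ → M) (t : ℝ) : TangentBundle (𝓡 n) M :=
  ⟨c t, mfderiv 𝓘(ℝ, ℝ) (𝓡 n) c t (1 : ℝ)⟩

end Manifolds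

/-- A Finsler space-time: a Lorentzian pseudo-Finsler structure. The function `L` is smooth on an
open cone bundle `dom` of non-zero tangent vectors with non-empty fibres, positively homogeneous of
degree two, and has a vertical Hessian of signature `(-, +, …, +)`. The slit tangent bundle is an
admissible `dom`; smaller ones admit, for instance, products in which the directions tangent to a
factor have to be left out. -/
structure FinslerSpacetime (n : ℕ) (M : Type*) [TopologicalSpace M]
    [ChartedSpace (EuclideanSpace ℝ (Fin n)) M] [IsManifold (𝓡 n) ∞ M] where
  /-- The admissible directions. -/
  dom : Set (TangentBundle (𝓡 n) M)
  /-- The Lagrangian (only its values on `dom` matter). -/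
  L : TangentBundle (𝓡 n) M → ℝ
  isOpen_dom : IsOpen dom
  dom_nonempty : ∀ x : M, ∃ v : TangentSpace (𝓡 n) x, (⟨x, v⟩ : TangentBundle (𝓡 n) M) ∈ dom
  dom_ne_zero : ∀ p ∈ dom, p.2 ≠ 0
  dom_cone : ∀ p ∈ dom, ∀ k : ℝ, 0 < k → (⟨p.1, k • p.2⟩ : TangentBundle (𝓡 n) M) ∈ dom
  smooth : ContMDiffOn (𝓡 n).tangent 𝓘(ℝ, ℝ) ∞ L dom
  homogeneous : ∀ p ∈ dom, ∀ k : ℝ, 0 < k → L ⟨p.1, k • p.2⟩ = k ^ 2 * L p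
  lorentzian : ∀ e ∈ IsManifold.maximalAtlas (𝓡 n) ∞ M, ∀ x ∈ e.target,
    ∀ y : EuclideanSpace ℝ (Fin n), chartVec e x y ∈ dom →
      IsLorentzian (vertHessian (fun u v => L (chartVec e u v)) x y)

namespace FinslerSpacetime

variable {n : ℕ} {M : Type*} [TopologicalSpace M] [ChartedSpace (EuclideanSpace ℝ (Fin n)) M]
  [IsManifold (𝓡 n) ∞ M]

/-- The Lagrangian in the coordinates of the chart `e`. -/
def localL (F : FinslerSpacetime n M) (e : OpenPartialHomeomorph M (EuclideanSpace ℝ (Fin n)))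
    (x y : EuclideanSpace ℝ (Fin n)) : ℝ :=
  F.L (chartVec e x y)

/-- The condition `R = 0`. -/
def RiemannFlat (F : FinslerSpacetime n M) : Prop :=
  ∀ e ∈ IsManifold.maximalAtlas (𝓡 n) ∞ M, ∀ x ∈ e.target, ∀ y : EuclideanSpace ℝ (Fin n),
    chartVec e x y ∈ F.dom → ∀ μ ν ρ σ, curvR (F.localL e) μ ν ρ σ x y = 0

/-- The condition `∇P = 0`: all horizontal and vertical covariant derivatives of the `hv`-curvature
vanish identically. -/
def NablaPVanishes (F : FinslerSpacetime n M) : Prop :=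
  ∀ e ∈ IsManifold.maximalAtlas (𝓡 n) ∞ M, ∀ x ∈ e.target, ∀ y : EuclideanSpace ℝ (Fin n),
    chartVec e x y ∈ F.dom → ∀ τ μ ν ρ σ,
      hcovP (F.localL e) τ μ ν ρ σ x y = 0 ∧ vcovP (F.localL e) τ μ ν ρ σ x y = 0

/-- `c` is a geodesic of the Finsler spray on the open set `I` of parameters: it has admissible
velocity and satisfies `ẍ^i + S^i(x, ẋ) = 0` in every chart. These are the world-lines of the
neutral point particles in a pure gravitational field. -/
def IsGeodesicOn (F : FinslerSpacetime n M) (c : ℝ → M) (I : Set ℝ) : Prop :=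
  ContMDiffOn 𝓘(ℝ, ℝ) (𝓡 n) 2 c I ∧
  (∀ t ∈ I, velocity c t ∈ F.dom) ∧
  ∀ e ∈ IsManifold.maximalAtlas (𝓡 n) ∞ M, ∀ t ∈ I, c t ∈ e.source → ∀ i,
    deriv (deriv (fun s => e (c s))) t i
      + sprayCoeff (F.localL e) i (e (c t)) (deriv (fun s => e (c s)) t) = 0

/-- The weak equivalence principle: for all initial conditions there is a free-fall world-line with
these initial conditions, and all free-fall world-lines with the same initial conditions coincide,
whatever the particles that follow them. -/
def WeakEquivalencePrinciple (F : FinslerSpacetime n M) : Prop :=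
  ∀ p ∈ F.dom, ∀ t₀ : ℝ,
    (∃ (c : ℝ → M) (a b : ℝ), t₀ ∈ Set.Ioo a b ∧ F.IsGeodesicOn c (Set.Ioo a b) ∧
      velocity c t₀ = p) ∧
    ∀ (c₁ c₂ : ℝ → M) (a b : ℝ), t₀ ∈ Set.Ioo a b →
      F.IsGeodesicOn c₁ (Set.Ioo a b) → F.IsGeodesicOn c₂ (Set.Ioo a b) →
      velocity c₁ t₀ = p → velocity c₂ t₀ = p → Set.EqOn c₁ c₂ (Set.Ioo a b)

/-- `e` is a freely falling coordinate system for the world-line `X` at the parameter `s₀`: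
* the connection coefficients `Γ^μ_{νρ}(X(s), y)` vanish for `s` near `s₀`, for all admissible `y`;
* in small coordinate balls about `X(s₀)` the curvature is negligible (at the scale of the ball),
  and the world-lines of free point particles are, to any prescribed accuracy, the
  straight lines `ẍ = 0` of special relativity. -/
def IsFreelyFallingChart (F : FinslerSpacetime n M) (X : ℝ → M) (s₀ : ℝ)
    (e : OpenPartialHomeomorph M (EuclideanSpace ℝ (Fin n))) : Prop :=
  X s₀ ∈ e.source ∧
  (∀ᶠ s in 𝓝 s₀, ∀ y : EuclideanSpace ℝ (Fin n), chartVec e (e (X s)) y ∈ F.dom →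
    ∀ μ ν ρ, chern (F.localL e) μ ν ρ (e (X s)) y = 0) ∧
  ∀ ε : ℝ, 0 < ε → ∃ r : ℝ, 0 < r ∧ Metric.ball (e (X s₀)) r ⊆ e.target ∧
    (∀ x ∈ Metric.ball (e (X s₀)) r, ∀ y : EuclideanSpace ℝ (Fin n), chartVec e x y ∈ F.dom →
      ∀ μ ν ρ σ, |curvR (F.localL e) μ ν ρ σ x y| * r ^ 2 ≤ ε) ∧
    (∀ (c : ℝ → M) (a b : ℝ), F.IsGeodesicOn c (Set.Ioo a b) → ∀ t ∈ Set.Ioo a b,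
      c t ∈ e.source → e (c t) ∈ Metric.ball (e (X s₀)) r →
        ‖deriv (deriv (fun s => e (c s))) t‖ ≤ ε * ‖deriv (fun s => e (c s)) t‖ ^ 2)

/-- Einstein's equivalence principle: the weak equivalence principle holds, and about every event on
a free-fall world-line there is a smooth freely falling coordinate system. -/
def EinsteinEquivalencePrinciple (F : FinslerSpacetime n M) : Prop :=
  F.WeakEquivalencePrinciple ∧
  ∀ (X : ℝ → M) (a b : ℝ), F.IsGeodesicOn X (Set.Ioo a b) → ∀ s₀ ∈ Set.Ioo a b,
    ∃ e ∈ IsManifold.maximalAtlas (𝓡 n) ∞ M, F.IsFreelyFallingChart X s₀ e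

/-- Schiff's conjecture for the space-time `F`. -/
def SchiffConjecture (F : FinslerSpacetime n M) : Prop :=
  F.WeakEquivalencePrinciple → F.EinsteinEquivalencePrinciple

end FinslerSpacetime

end FinslerGravity

end

/-! Einstein's principle asks for a chart in which the Chern coefficients vanish over an event for
all admissible velocities at once. Under a change of coordinates `φ` these coefficients behave like
those of an affine connection: besides the tensorial part there is only a term in `D²φ`, which does
not see the velocity `y`. So in any other chart `Γ` over that event is `(Dφ)⁻¹ D²φ`, independent of
`y`. Geodesics exist through every admissible initial velocity, so this happens on all of `dom`;
hence `P = ∂Γ/∂y` vanishes identically, and so do its covariant derivatives. This contradicts `∇P ≠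
0`.

The transformation law (`IsLagrangianChange.christoffelForm_apply`) rests on two facts: the fibre
metric is a tensor, and the horizontal lift is invariant, because the term `D²φ(y, y)` in the law of
the spray becomes, after half a fibre derivative, the term by which `φ` tilts horizontal vectors.
These computations use Fréchet derivatives on `E × E`; the index formulas are identified with them
afterwards.

The weak principle is the theory of ODEs for the geodesic field: Picard-Lindelöf for existence,
local uniqueness and connectedness of the interval for uniqueness (`weakEquivalencePrinciple`). -/

noncomputable section

namespace FinslerGravity

/-! ### Coordinate-free calculus of a Lagrangian on an open set of position-velocity pairs -/

section Invariant

variable {E : Type*} [NormedAddCommGroup E] [NormedSpace ℝ E]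

/-- The fibre derivative of a Lagrangian. -/
def momentum (F : E × E → ℝ) (p : E × E) : E →L[ℝ] ℝ :=
  (fderiv ℝ F p).comp (ContinuousLinearMap.inr ℝ E E)

/-- The second fibre derivative of a Lagrangian. -/
def fiberMetric (F : E × E → ℝ) (p : E × E) : E →L[ℝ] E →L[ℝ] ℝ :=
  (fderiv ℝ (momentum F) p).comp (ContinuousLinearMap.inr ℝ E E)

/-- The part of the Euler-Lagrange expression that contains no acceleration. -/
def eulerForm (F : E × E → ℝ) (p : E × E) : E →L[ℝ] ℝ :=
  fderiv ℝ (momentum F) p (p.2, 0) - (fderiv ℝ F p).comp (ContinuousLinearMap.inl ℝ E E)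

/-- The horizontal lift of the non-linear connection of a spray. -/
def horizontalLift (S : E × E → E) (p : E × E) : E →L[ℝ] E × E :=
  (ContinuousLinearMap.id ℝ E).prod
    (-((1 / 2 : ℝ) • (fderiv ℝ S p).comp (ContinuousLinearMap.inr ℝ E E)))

/-- The Christoffel symbols of the first kind of the Chern connection. -/
def christoffelForm (F : E × E → ℝ) (S : E × E → E) (p : E × E) (u v w : E) : ℝ :=
  1 / 2 * (fderiv ℝ (fiberMetric F) p (horizontalLift S p u) w v
    + fderiv ℝ (fiberMetric F) p (horizontalLift S p v) w u
    - fderiv ℝ (fiberMetric F) p (horizontalLift S p w) u v)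

/-- A smooth Lagrangian on an open set. -/
structure IsSmoothLagrangian (F : E × E → ℝ) (U : Set (E × E)) : Prop where
  isOpen : IsOpen U
  contDiffOn : ContDiffOn ℝ ∞ F U

/-- A smooth Lagrangian with non-degenerate fibre metric on an open set. -/
structure IsRegularLagrangian (F : E × E → ℝ) (U : Set (E × E)) : Prop
    extends IsSmoothLagrangian F U where
  nondegenerate : ∀ p ∈ U, ∀ v, (∀ w, fiberMetric F p v w = 0) → v = 0

/-- `S` is the spray of the Lagrangian `F` on `U`. -/
def IsSprayOf (S : E × E → E) (F : E × E → ℝ) (U : Set (E × E)) : Prop :=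
  ∀ p ∈ U, ∀ w, fiberMetric F p (S p) w = eulerForm F p w

/-- The action of a change of coordinates on positions and velocities. -/
def prolong (φ : E → E) (p : E × E) : E × E := (φ p.1, fderiv ℝ φ p.1 p.2)

/-- A change of coordinates on `W` that takes the Lagrangian `F` on `U` to `F'` on `U'`. -/
structure IsLagrangianChange (φ : E → E) (W : Set E) (F : E × E → ℝ) (U : Set (E × E))
    (F' : E × E → ℝ) (U' : Set (E × E)) : Prop where
  isOpen : IsOpen W
  contDiffOn : ContDiffOn ℝ ∞ φ W
  surjective : ∀ x ∈ W, Function.Surjective (fderiv ℝ φ x)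
  mapsTo : ∀ p ∈ U, p.1 ∈ W → prolong φ p ∈ U'
  eq_comp : ∀ p ∈ U, p.1 ∈ W → F p = F' (prolong φ p)

/-! ### Regularity of the fibre derivatives and of the spray. -/

namespace IsSmoothLagrangian

variable {F : E × E → ℝ} {U : Set (E × E)}

lemma contDiffAt (h : IsSmoothLagrangian F U) {p : E × E} (hp : p ∈ U) : ContDiffAt ℝ ∞ F p :=
  h.contDiffOn.contDiffAt (h.isOpen.mem_nhds hp)

lemma contDiffAt_momentum (h : IsSmoothLagrangian F U) {p : E × E} (hp : p ∈ U) :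
    ContDiffAt ℝ ∞ (momentum F) p :=
  ((h.contDiffAt hp).fderiv_right (m := ∞) (by simp)).clm_comp contDiffAt_const

lemma contDiffAt_fiberMetric (h : IsSmoothLagrangian F U) {p : E × E} (hp : p ∈ U) :
    ContDiffAt ℝ ∞ (fiberMetric F) p :=
  ((h.contDiffAt_momentum hp).fderiv_right (m := ∞) (by simp)).clm_comp contDiffAt_const

lemma contDiffAt_eulerForm (h : IsSmoothLagrangian F U) {p : E × E} (hp : p ∈ U) :
    ContDiffAt ℝ ∞ (eulerForm F) p :=
  (((h.contDiffAt_momentum hp).fderiv_right (m := ∞) (by simp)).clm_apply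
    (contDiffAt_snd.prodMk contDiffAt_const)).sub
      (((h.contDiffAt hp).fderiv_right (m := ∞) (by simp)).clm_comp contDiffAt_const)

lemma fiberMetric_apply (h : IsSmoothLagrangian F U) {p : E × E} (hp : p ∈ U) (v w : E) :
    fiberMetric F p v w = fderiv ℝ (fderiv ℝ F) p (0, v) (0, w) := by
  have h1 : HasFDerivAt (fderiv ℝ F) (fderiv ℝ (fderiv ℝ F) p) p :=
    (((h.contDiffAt hp).fderiv_right (m := ∞) (by simp)).differentiableAt
      (by simp)).hasFDerivAt
  have h2 := h1.clm_comp (hasFDerivAt_const (ContinuousLinearMap.inr ℝ E E) p)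
  have h3 : fderiv ℝ (momentum F) p = _ := h2.fderiv
  simp [fiberMetric, h3]

lemma fiberMetric_symm (h : IsSmoothLagrangian F U) {p : E × E} (hp : p ∈ U) (v w : E) :
    fiberMetric F p v w = fiberMetric F p w v := by
  rw [h.fiberMetric_apply hp, h.fiberMetric_apply hp]
  exact ((h.contDiffAt hp).isSymmSndFDerivAt (by simpa using ENat.LEInfty.out)) _ _

end IsSmoothLagrangian

namespace IsRegularLagrangian

variable {F : E × E → ℝ} {U : Set (E × E)}

lemma eq_of_fiberMetric_eq (h : IsRegularLagrangian F U) {p : E × E} (hp : p ∈ U) {a b : E}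
    (hab : ∀ w, fiberMetric F p a w = fiberMetric F p b w) : a = b :=
  sub_eq_zero.1 (h.nondegenerate p hp _ fun w => by simp [hab w])

/-- The spray of a regular Lagrangian is smooth. -/
lemma contDiffAt_spray [FiniteDimensional ℝ E] (h : IsRegularLagrangian F U) {S : E × E → E}
    (hS : IsSprayOf S F U) {p : E × E} (hp : p ∈ U) : ContDiffAt ℝ ∞ S p := by
  have hequiv : ∀ q ∈ U, ∃ G : E ≃L[ℝ] (E →L[ℝ] ℝ), (G : E →L[ℝ] E →L[ℝ] ℝ) = fiberMetric F q := by
    intro q hq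
    have hinj : Function.Injective (fiberMetric F q : E →ₗ[ℝ] E →L[ℝ] ℝ) := fun a b hab =>
      h.eq_of_fiberMetric_eq hq fun w => by
        simpa using congrArg (fun f : E →L[ℝ] ℝ => f w) hab
    have hdim : Module.finrank ℝ E = Module.finrank ℝ (E →L[ℝ] ℝ) := by
      rw [← (LinearMap.toContinuousLinearMap (𝕜 := ℝ) (E := E) (F' := ℝ)).finrank_eq]
      exact (Subspace.dual_finrank_eq (K := ℝ) (V := E)).symm
    refine ⟨(LinearEquiv.ofInjectiveOfFinrankEq _ hinj hdim).toContinuousLinearEquiv, ?_⟩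
    ext v w
    rfl
  -- The spray is the Euler form with its index raised; operator inversion is smooth at invertible
  -- maps, so smoothness follows by composition.
  have hEq : S =ᶠ[𝓝 p] fun q => (fiberMetric F q).inverse (eulerForm F q) := by
    filter_upwards [h.isOpen.mem_nhds hp] with q hq
    obtain ⟨G, hG⟩ := hequiv q hq
    have : eulerForm F q = G (S q) := by
      ext w
      rw [← hS q hq w, ← hG]
      rfl
    rw [this, ← hG, ContinuousLinearMap.inverse_equiv]
    simp
  refine ContDiffAt.congr_of_eventuallyEq ?_ hEq
  obtain ⟨G, hG⟩ := hequiv p hp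
  have hinv : ContDiffAt ℝ ∞ ContinuousLinearMap.inverse (fiberMetric F p) := by
    rw [← hG]
    have : CompleteSpace E := FiniteDimensional.complete ℝ E
    exact contDiffAt_map_inverse G
  exact (hinv.comp p (h.contDiffAt_fiberMetric hp)).clm_apply (h.contDiffAt_eulerForm hp)

end IsRegularLagrangian

lemma hasFDerivAt_prolong {φ : E → E} {p : E × E} (hφ : ContDiffAt ℝ ∞ φ p.1) :
    HasFDerivAt (prolong φ)
      (((fderiv ℝ φ p.1).comp (ContinuousLinearMap.fst ℝ E E)).prod
        ((fderiv ℝ φ p.1).comp (ContinuousLinearMap.snd ℝ E E)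
          + ((fderiv ℝ (fderiv ℝ φ) p.1).comp (ContinuousLinearMap.fst ℝ E E)).flip p.2)) p := by
  have h1 : HasFDerivAt φ (fderiv ℝ φ p.1) p.1 :=
    (hφ.differentiableAt (by simp)).hasFDerivAt
  have h2 : HasFDerivAt (fderiv ℝ φ) (fderiv ℝ (fderiv ℝ φ) p.1) p.1 :=
    ((hφ.fderiv_right (m := ∞) (by simp)).differentiableAt (by simp)).hasFDerivAt
  exact (h1.comp p hasFDerivAt_fst).prodMk
    ((h2.comp p hasFDerivAt_fst).clm_apply hasFDerivAt_snd)

/-- All inhomogeneous terms below come from the `D²φ` here. It depends on the position part `u`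
only, so vertical vectors transform as tensors. -/
lemma fderiv_prolong_apply {φ : E → E} {p : E × E} (hφ : ContDiffAt ℝ ∞ φ p.1) (u v : E) :
    fderiv ℝ (prolong φ) p (u, v)
      = (fderiv ℝ φ p.1 u, fderiv ℝ φ p.1 v + fderiv ℝ (fderiv ℝ φ) p.1 u p.2) := by
  rw [(hasFDerivAt_prolong hφ).fderiv]
  simp

/-! ### Transformation laws under a change of coordinates. -/

namespace IsLagrangianChange

variable {φ : E → E} {W : Set E} {F F' : E × E → ℝ} {U U' : Set (E × E)}

lemma contDiffAt (h : IsLagrangianChange φ W F U F' U') {x : E} (hx : x ∈ W) :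
    ContDiffAt ℝ ∞ φ x :=
  h.contDiffOn.contDiffAt (h.isOpen.mem_nhds hx)

lemma eventually_mem (h : IsLagrangianChange φ W F U F' U') (hF : IsRegularLagrangian F U)
    {p : E × E} (hp : p ∈ U) (hx : p.1 ∈ W) : ∀ᶠ q in 𝓝 p, q ∈ U ∧ q.1 ∈ W :=
  Filter.Eventually.and (hF.isOpen.mem_nhds hp) (continuous_fst.continuousAt (h.isOpen.mem_nhds hx))

lemma fderiv_second_symm (h : IsLagrangianChange φ W F U F' U') {x : E} (hx : x ∈ W) (u v : E) :
    fderiv ℝ (fderiv ℝ φ) x u v = fderiv ℝ (fderiv ℝ φ) x v u :=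
  ((h.contDiffAt hx).isSymmSndFDerivAt (by simpa using ENat.LEInfty.out)) _ _

lemma fderiv_comp_prolong {V : Type*} [NormedAddCommGroup V] [NormedSpace ℝ V] {f : E × E → V}
    (h : IsLagrangianChange φ W F U F' U') {p : E × E}
    (hx : p.1 ∈ W) (hf : DifferentiableAt ℝ f (prolong φ p)) (u v : E) :
    fderiv ℝ (f ∘ prolong φ) p (u, v) = fderiv ℝ f (prolong φ p)
      (fderiv ℝ φ p.1 u, fderiv ℝ φ p.1 v + fderiv ℝ (fderiv ℝ φ) p.1 u p.2) := by
  rw [fderiv_comp p hf (hasFDerivAt_prolong (h.contDiffAt hx)).differentiableAt,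
    ContinuousLinearMap.comp_apply, fderiv_prolong_apply (h.contDiffAt hx)]

lemma fderiv_lagrangian (h : IsLagrangianChange φ W F U F' U') (hF : IsRegularLagrangian F U)
    (hF' : IsRegularLagrangian F' U') {p : E × E} (hp : p ∈ U) (hx : p.1 ∈ W) (u v : E) :
    fderiv ℝ F p (u, v) = fderiv ℝ F' (prolong φ p)
      (fderiv ℝ φ p.1 u, fderiv ℝ φ p.1 v + fderiv ℝ (fderiv ℝ φ) p.1 u p.2) := by
  have hE : F =ᶠ[𝓝 p] F' ∘ prolong φ := by
    filter_upwards [h.eventually_mem hF hp hx] with q hq using h.eq_comp q hq.1 hq.2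
  rw [hE.fderiv_eq, h.fderiv_comp_prolong hx
    ((hF'.contDiffAt (h.mapsTo p hp hx)).differentiableAt (by simp))]

lemma momentum_apply (h : IsLagrangianChange φ W F U F' U') (hF : IsRegularLagrangian F U)
    (hF' : IsRegularLagrangian F' U') {p : E × E} (hp : p ∈ U) (hx : p.1 ∈ W) (v : E) :
    momentum F p v = momentum F' (prolong φ p) (fderiv ℝ φ p.1 v) := by
  simp [momentum, h.fderiv_lagrangian hF hF' hp hx]

lemma hasFDerivAt_fderiv_fst_apply (h : IsLagrangianChange φ W F U F' U') {p : E × E}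
    (hx : p.1 ∈ W) (w : E) :
    HasFDerivAt (fun q : E × E => fderiv ℝ φ q.1 w)
      (((fderiv ℝ (fderiv ℝ φ) p.1).flip w).comp (ContinuousLinearMap.fst ℝ E E)) p := by
  have h2 : HasFDerivAt (fderiv ℝ φ) (fderiv ℝ (fderiv ℝ φ) p.1) p.1 :=
    (((h.contDiffAt hx).fderiv_right (m := ∞) (by simp)).differentiableAt (by simp)).hasFDerivAt
  have h3 := (h2.comp p hasFDerivAt_fst).clm_apply (hasFDerivAt_const w p)
  refine h3.congr_fderiv ?_
  ext <;> simp

/-- Product rule for the tensorial law of the momentum; the last term is the derivative of the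
factor `Dφ w`. For `u = 0` both `D²φ` terms drop out, which makes the fibre metric a tensor. -/
lemma fderiv_momentum_apply (h : IsLagrangianChange φ W F U F' U')
    (hF : IsRegularLagrangian F U) (hF' : IsRegularLagrangian F' U') {p : E × E} (hp : p ∈ U)
    (hx : p.1 ∈ W) (u v w : E) :
    fderiv ℝ (momentum F) p (u, v) w
      = fderiv ℝ (momentum F') (prolong φ p)
          (fderiv ℝ φ p.1 u, fderiv ℝ φ p.1 v + fderiv ℝ (fderiv ℝ φ) p.1 u p.2)
          (fderiv ℝ φ p.1 w)
        + momentum F' (prolong φ p) (fderiv ℝ (fderiv ℝ φ) p.1 u w) := by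
  have hdF : HasFDerivAt (momentum F) (fderiv ℝ (momentum F) p) p :=
    ((hF.contDiffAt_momentum hp).differentiableAt (by simp)).hasFDerivAt
  have hdF' : DifferentiableAt ℝ (momentum F') (prolong φ p) :=
    (hF'.contDiffAt_momentum (h.mapsTo p hp hx)).differentiableAt (by simp)
  have hdc : HasFDerivAt (momentum F' ∘ prolong φ) (fderiv ℝ (momentum F' ∘ prolong φ) p) p :=
    (hdF'.comp p (hasFDerivAt_prolong (h.contDiffAt hx)).differentiableAt).hasFDerivAt
  have hl := hdF.clm_apply (hasFDerivAt_const w p)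
  have hr := hdc.clm_apply (h.hasFDerivAt_fderiv_fst_apply hx w)
  have hE : (fun q => momentum F q w)
      =ᶠ[𝓝 p] fun q => (momentum F' ∘ prolong φ) q (fderiv ℝ φ q.1 w) := by
    filter_upwards [h.eventually_mem hF hp hx] with q hq
    exact h.momentum_apply hF hF' hq.1 hq.2 w
  have := congrArg (fun f : E × E →L[ℝ] ℝ => f (u, v)) (hl.unique (hr.congr_of_eventuallyEq hE))
  simp only [add_apply, ContinuousLinearMap.comp_apply,
    ContinuousLinearMap.flip_apply, h.fderiv_comp_prolong hx hdF'] at this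
  simpa [add_comm] using this

lemma fiberMetric_apply (h : IsLagrangianChange φ W F U F' U') (hF : IsRegularLagrangian F U)
    (hF' : IsRegularLagrangian F' U') {p : E × E} (hp : p ∈ U) (hx : p.1 ∈ W) (v w : E) :
    fiberMetric F p v w
      = fiberMetric F' (prolong φ p) (fderiv ℝ φ p.1 v) (fderiv ℝ φ p.1 w) := by
  simp [fiberMetric, h.fderiv_momentum_apply hF hF' hp hx]

/-- The two halves of the Euler form each produce the momentum of `D²φ(y, w)`, and these cancel by
symmetry of `D²φ`. Only the metric term with `D²φ(y, y)` survives. -/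
lemma eulerForm_apply (h : IsLagrangianChange φ W F U F' U') (hF : IsRegularLagrangian F U)
    (hF' : IsRegularLagrangian F' U') {p : E × E} (hp : p ∈ U) (hx : p.1 ∈ W) (w : E) :
    eulerForm F p w = eulerForm F' (prolong φ p) (fderiv ℝ φ p.1 w)
      + fiberMetric F' (prolong φ p) (fderiv ℝ (fderiv ℝ φ) p.1 p.2 p.2) (fderiv ℝ φ p.1 w) := by
  have hsplit : ∀ a b : E, ((a, b) : E × E) = (a, 0) + (0, b) := by simp
  simp only [eulerForm, fiberMetric, sub_apply,
    ContinuousLinearMap.comp_apply, ContinuousLinearMap.inl_apply, ContinuousLinearMap.inr_apply,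
    h.fderiv_momentum_apply hF hF' hp hx, h.fderiv_lagrangian hF hF' hp hx, momentum,
    map_zero, zero_add, h.fderiv_second_symm hx w p.2]
  rw [hsplit _ (fderiv ℝ (fderiv ℝ φ) p.1 p.2 p.2),
    hsplit (fderiv ℝ φ p.1 w) (fderiv ℝ (fderiv ℝ φ) p.1 p.2 w)]
  simp only [map_add, add_apply, prolong]
  ring

/-- The inhomogeneous transformation law of the spray. -/
lemma spray_apply (h : IsLagrangianChange φ W F U F' U') (hF : IsRegularLagrangian F U)
    (hF' : IsRegularLagrangian F' U') {S S' : E × E → E} (hS : IsSprayOf S F U)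
    (hS' : IsSprayOf S' F' U') {p : E × E} (hp : p ∈ U) (hx : p.1 ∈ W) :
    fderiv ℝ φ p.1 (S p) = S' (prolong φ p) + fderiv ℝ (fderiv ℝ φ) p.1 p.2 p.2 := by
  refine hF'.eq_of_fiberMetric_eq (h.mapsTo p hp hx) fun w' => ?_
  obtain ⟨w, rfl⟩ := h.surjective p.1 hx w'
  rw [← h.fiberMetric_apply hF hF' hp hx, hS p hp, h.eulerForm_apply hF hF' hp hx, map_add,
    add_apply, hS' _ (h.mapsTo p hp hx)]

/-- The horizontal lift is invariant under changes of coordinates. -/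
lemma fderiv_prolong_horizontalLift [FiniteDimensional ℝ E] (h : IsLagrangianChange φ W F U F' U')
    (hF : IsRegularLagrangian F U) (hF' : IsRegularLagrangian F' U') {S S' : E × E → E}
    (hS : IsSprayOf S F U) (hS' : IsSprayOf S' F' U') {p : E × E} (hp : p ∈ U) (hx : p.1 ∈ W)
    (u : E) :
    fderiv ℝ (prolong φ) p (horizontalLift S p u)
      = horizontalLift S' (prolong φ p) (fderiv ℝ φ p.1 u) := by
  have hdS : HasFDerivAt S (fderiv ℝ S p) p :=
    ((hF.contDiffAt_spray hS hp).differentiableAt (by simp)).hasFDerivAt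
  have hdS' : DifferentiableAt ℝ S' (prolong φ p) :=
    (hF'.contDiffAt_spray hS' (h.mapsTo p hp hx)).differentiableAt (by simp)
  have hdc : HasFDerivAt (S' ∘ prolong φ) (fderiv ℝ (S' ∘ prolong φ) p) p :=
    (hdS'.comp p (hasFDerivAt_prolong (h.contDiffAt hx)).differentiableAt).hasFDerivAt
  have hvert : HasFDerivAt (fun v : E => ((p.1, v) : E × E)) (ContinuousLinearMap.inr ℝ E E) p.2 :=
    hasFDerivAt_prodMk_right p.1 p.2
  -- The law of the spray is differentiated along the fibre at fixed position. The term `D²φ(v, v)`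
  -- yields `2 D²φ(y, u)`, and the `1/2` in the non-linear connection makes this cancel against the
  -- `D²φ` of the prolongation.
  have hl : HasFDerivAt (fun v => fderiv ℝ φ p.1 (S (p.1, v)))
      ((fderiv ℝ φ p.1).comp ((fderiv ℝ S p).comp (ContinuousLinearMap.inr ℝ E E))) p.2 :=
    (fderiv ℝ φ p.1).hasFDerivAt.comp p.2 (HasFDerivAt.comp p.2 (f := fun v : E => (p.1, v))
      (g := S) hdS hvert)
  have hr := (HasFDerivAt.comp p.2 (f := fun v : E => (p.1, v)) (g := S' ∘ prolong φ) hdc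
    hvert).add (((fderiv ℝ (fderiv ℝ φ) p.1).hasFDerivAt (x := p.2)).clm_apply (hasFDerivAt_id p.2))
  have hE : (fun v => fderiv ℝ φ p.1 (S (p.1, v))) =ᶠ[𝓝 p.2]
      fun v => ((S' ∘ prolong φ) ∘ fun v : E => (p.1, v)) v + fderiv ℝ (fderiv ℝ φ) p.1 v v := by
    have hc : Filter.Tendsto (fun v : E => ((p.1, v) : E × E)) (𝓝 p.2) (𝓝 p) :=
      hvert.continuousAt
    filter_upwards [hc.eventually (h.eventually_mem hF hp hx)] with v hv
    exact h.spray_apply hF hF' hS hS' hv.1 hv.2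
  have key := congrArg (fun f : E →L[ℝ] E => f u) (hl.unique (hr.congr_of_eventuallyEq hE))
  simp only [ContinuousLinearMap.comp_apply, add_apply,
    ContinuousLinearMap.inr_apply, ContinuousLinearMap.flip_apply,
    h.fderiv_comp_prolong hx hdS', map_zero, zero_apply, add_zero,
    ContinuousLinearMap.id_apply, id, h.fderiv_second_symm hx p.2 u] at key
  have hlift : horizontalLift S p u = (u, -((1 / 2 : ℝ) • fderiv ℝ S p (0, u))) := by
    simp [horizontalLift]
  rw [hlift, fderiv_prolong_apply (h.contDiffAt hx), map_neg, map_smul, key]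
  simp only [horizontalLift, ContinuousLinearMap.prod_apply, ContinuousLinearMap.id_apply,
    neg_apply, smul_apply, ContinuousLinearMap.comp_apply,
    ContinuousLinearMap.inr_apply, Prod.mk.injEq, true_and]
  module

lemma fderiv_fiberMetric_apply (h : IsLagrangianChange φ W F U F' U')
    (hF : IsRegularLagrangian F U) (hF' : IsRegularLagrangian F' U') {p : E × E} (hp : p ∈ U)
    (hx : p.1 ∈ W) (X : E × E) (v w : E) :
    fderiv ℝ (fiberMetric F) p X v w
      = fderiv ℝ (fiberMetric F') (prolong φ p) (fderiv ℝ (prolong φ) p X)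
          (fderiv ℝ φ p.1 v) (fderiv ℝ φ p.1 w)
        + fiberMetric F' (prolong φ p) (fderiv ℝ (fderiv ℝ φ) p.1 X.1 v) (fderiv ℝ φ p.1 w)
        + fiberMetric F' (prolong φ p) (fderiv ℝ φ p.1 v)
            (fderiv ℝ (fderiv ℝ φ) p.1 X.1 w) := by
  have hdF : HasFDerivAt (fiberMetric F) (fderiv ℝ (fiberMetric F) p) p :=
    ((hF.contDiffAt_fiberMetric hp).differentiableAt (by simp)).hasFDerivAt
  have hdF' : DifferentiableAt ℝ (fiberMetric F') (prolong φ p) :=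
    (hF'.contDiffAt_fiberMetric (h.mapsTo p hp hx)).differentiableAt (by simp)
  have hdT := (hasFDerivAt_prolong (h.contDiffAt hx)).differentiableAt
  have hdc := HasFDerivAt.comp (g := fiberMetric F') p hdF'.hasFDerivAt hdT.hasFDerivAt
  have hl := (hdF.clm_apply (hasFDerivAt_const v p)).clm_apply (hasFDerivAt_const w p)
  have hr := (hdc.clm_apply (h.hasFDerivAt_fderiv_fst_apply hx v)).clm_apply
    (h.hasFDerivAt_fderiv_fst_apply hx w)
  have hE : (fun q => fiberMetric F q v w) =ᶠ[𝓝 p]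
      fun q => (fiberMetric F' ∘ prolong φ) q (fderiv ℝ φ q.1 v) (fderiv ℝ φ q.1 w) := by
    filter_upwards [h.eventually_mem hF hp hx] with q hq
    exact h.fiberMetric_apply hF hF' hq.1 hq.2 v w
  have := congrArg (fun f : E × E →L[ℝ] ℝ => f X) (hl.unique (hr.congr_of_eventuallyEq hE))
  simp only [add_apply, ContinuousLinearMap.comp_apply,
    ContinuousLinearMap.flip_apply, zero_apply, map_zero, zero_add,
    Function.comp_apply, ContinuousLinearMap.coe_fst'] at this
  rw [this]
  ring

/-- The inhomogeneous transformation law of the Christoffel symbols of the first kind. -/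
lemma christoffelForm_apply [FiniteDimensional ℝ E] (h : IsLagrangianChange φ W F U F' U')
    (hF : IsRegularLagrangian F U) (hF' : IsRegularLagrangian F' U') {S S' : E × E → E}
    (hS : IsSprayOf S F U) (hS' : IsSprayOf S' F' U') {p : E × E} (hp : p ∈ U) (hx : p.1 ∈ W)
    (u v w : E) :
    christoffelForm F S p u v w
      = christoffelForm F' S' (prolong φ p) (fderiv ℝ φ p.1 u) (fderiv ℝ φ p.1 v)
          (fderiv ℝ φ p.1 w)
        + fiberMetric F' (prolong φ p) (fderiv ℝ (fderiv ℝ φ) p.1 u v) (fderiv ℝ φ p.1 w) := by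
  have hfst : ∀ a, (horizontalLift S p a).1 = a := fun a => by simp [horizontalLift]
  simp only [christoffelForm, h.fderiv_fiberMetric_apply hF hF' hp hx, hfst,
    h.fderiv_prolong_horizontalLift hF hF' hS hS' hp hx]
  -- Of the six `D²φ` terms four cancel in pairs, as for the Levi-Civita connection; the remaining
  -- two are equal and absorb the factor `1/2`.
  rw [h.fderiv_second_symm hx w u, h.fderiv_second_symm hx w v, h.fderiv_second_symm hx v u,
    hF'.fiberMetric_symm (h.mapsTo p hp hx) (fderiv ℝ φ p.1 w)
      (fderiv ℝ (fderiv ℝ φ) p.1 u v),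
    hF'.fiberMetric_symm (h.mapsTo p hp hx) (fderiv ℝ φ p.1 u)
      (fderiv ℝ (fderiv ℝ φ) p.1 v w)]
  ring

end IsLagrangianChange

end Invariant

/-! ### The coordinate expressions in coordinate-free terms -/

section Coordinates

variable {n : ℕ}

/-- The standard basis vectors of the coordinate space. -/
abbrev coordVec (i : Fin n) : EuclideanSpace ℝ (Fin n) := EuclideanSpace.single i 1

/-- To prove a linear statement, it is enough to check the coordinate vectors. -/
lemma coordVec_induction {P : EuclideanSpace ℝ (Fin n) → Prop} (single : ∀ i, P (coordVec i))
    (zero : P 0) (add : ∀ u v, P u → P v → P (u + v)) (smul : ∀ (a : ℝ) u, P u → P (a • u))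
    (u : EuclideanSpace ℝ (Fin n)) : P u := by
  have hu : u ∈ Submodule.span ℝ (Set.range (EuclideanSpace.basisFun (Fin n) ℝ)) := by
    rw [← OrthonormalBasis.coe_toBasis, Module.Basis.span_eq]
    trivial
  induction hu using Submodule.span_induction with
  | mem x h =>
    obtain ⟨i, rfl⟩ := h
    simpa using single i
  | zero => exact zero
  | add x y _ _ hx hy => exact add x y hx hy
  | smul a x _ hx => exact smul a x hx

lemma sum_smul_coordVec (u : EuclideanSpace ℝ (Fin n)) : ∑ i, u i • coordVec i = u := by
  ext j
  simp [coordVec, Pi.single_apply]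

/-- Bridge from partial derivatives to Fréchet derivatives. A germ suffices, so that identities
known only on the open set `U` can be differentiated. -/
lemma dx_eq_fderiv {f : EuclideanSpace ℝ (Fin n) → EuclideanSpace ℝ (Fin n) → ℝ}
    {g : EuclideanSpace ℝ (Fin n) × EuclideanSpace ℝ (Fin n) → ℝ}
    {p : EuclideanSpace ℝ (Fin n) × EuclideanSpace ℝ (Fin n)}
    (h : Function.uncurry f =ᶠ[𝓝 p] g) (hg : DifferentiableAt ℝ g p) (i : Fin n) :
    dx i f p.1 p.2 = fderiv ℝ g p (coordVec i, 0) := by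
  have h1 := HasFDerivAt.comp p.1 (f := fun z => (z, p.2)) (g := Function.uncurry f)
    (hg.hasFDerivAt.congr_of_eventuallyEq h) (hasFDerivAt_prodMk_left p.1 p.2)
  have h2 : fderiv ℝ (fun z => f z p.2) p.1 = _ := h1.fderiv
  simp [dx, h2]

lemma dy_eq_fderiv {f : EuclideanSpace ℝ (Fin n) → EuclideanSpace ℝ (Fin n) → ℝ}
    {g : EuclideanSpace ℝ (Fin n) × EuclideanSpace ℝ (Fin n) → ℝ}
    {p : EuclideanSpace ℝ (Fin n) × EuclideanSpace ℝ (Fin n)}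
    (h : Function.uncurry f =ᶠ[𝓝 p] g) (hg : DifferentiableAt ℝ g p) (i : Fin n) :
    dy i f p.1 p.2 = fderiv ℝ g p (0, coordVec i) := by
  have h1 := HasFDerivAt.comp p.2 (f := fun z => (p.1, z)) (g := Function.uncurry f)
    (hg.hasFDerivAt.congr_of_eventuallyEq h) (hasFDerivAt_prodMk_right p.1 p.2)
  have h2 : fderiv ℝ (fun z => f p.1 z) p.2 = _ := h1.fderiv
  simp [dy, h2]

/-- The spray coefficients as a vector. -/
def sprayVec (ℓ : EuclideanSpace ℝ (Fin n) → EuclideanSpace ℝ (Fin n) → ℝ)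
    (p : EuclideanSpace ℝ (Fin n) × EuclideanSpace ℝ (Fin n)) : EuclideanSpace ℝ (Fin n) :=
  WithLp.toLp 2 fun i => sprayCoeff ℓ i p.1 p.2

/-- The coefficients of the Chern connection as a vector. -/
def chernVec (ℓ : EuclideanSpace ℝ (Fin n) → EuclideanSpace ℝ (Fin n) → ℝ) (j k : Fin n)
    (p : EuclideanSpace ℝ (Fin n) × EuclideanSpace ℝ (Fin n)) : EuclideanSpace ℝ (Fin n) :=
  WithLp.toLp 2 fun i => chern ℓ i j k p.1 p.2

lemma IsLorentzian.isUnit_det {g : Matrix (Fin n) (Fin n) ℝ} (h : IsLorentzian g) :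
    IsUnit g.det := by
  obtain ⟨A, i₀, -, hA⟩ := h
  have hd := congrArg Matrix.det hA
  rw [Matrix.det_mul, Matrix.det_mul, Matrix.det_diagonal] at hd
  refine isUnit_iff_ne_zero.2 fun h0 => ?_
  rw [h0, mul_zero, zero_mul] at hd
  refine Finset.prod_ne_zero_iff.2 (fun i _ => ?_) hd.symm
  split_ifs <;> norm_num

lemma sum_mul_inv_mul {g : Matrix (Fin n) (Fin n) ℝ} (hg : IsUnit g.det) (b : Fin n → ℝ)
    (l : Fin n) : ∑ i, g l i * ∑ m, g⁻¹ i m * b m = b l := by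
  have h : g.mulVec (g⁻¹.mulVec b) = b := by
    rw [Matrix.mulVec_mulVec, Matrix.mul_nonsing_inv g hg, Matrix.one_mulVec]
  simpa [Matrix.mulVec, dotProduct] using congrFun h l

variable {ℓ : EuclideanSpace ℝ (Fin n) → EuclideanSpace ℝ (Fin n) → ℝ}
  {U : Set (EuclideanSpace ℝ (Fin n) × EuclideanSpace ℝ (Fin n))}

/-! ### Index formulas for the spray and the Chern connection as Fréchet derivatives. -/

namespace IsSmoothLagrangian

lemma eventuallyEq_of_eqOn {V : Type*}
    {f g : EuclideanSpace ℝ (Fin n) × EuclideanSpace ℝ (Fin n) → V}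
    (h : IsSmoothLagrangian (Function.uncurry ℓ) U) (hfg : Set.EqOn f g U)
    {p : EuclideanSpace ℝ (Fin n) × EuclideanSpace ℝ (Fin n)} (hp : p ∈ U) : f =ᶠ[𝓝 p] g :=
  hfg.eventuallyEq_of_mem (h.isOpen.mem_nhds hp)

lemma dy_eq (h : IsSmoothLagrangian (Function.uncurry ℓ) U) (j : Fin n) :
    Set.EqOn (Function.uncurry (dy j ℓ)) (fun q => momentum (Function.uncurry ℓ) q (coordVec j))
      U := fun q hq => by
  change dy j ℓ q.1 q.2 = _
  rw [dy_eq_fderiv (Filter.EventuallyEq.refl _ _) ((h.contDiffAt hq).differentiableAt (by simp))]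
  simp [momentum]

lemma hasFDerivAt_momentum_apply (h : IsSmoothLagrangian (Function.uncurry ℓ) U)
    {p : EuclideanSpace ℝ (Fin n) × EuclideanSpace ℝ (Fin n)} (hp : p ∈ U)
    (w : EuclideanSpace ℝ (Fin n)) :
    HasFDerivAt (fun q => momentum (Function.uncurry ℓ) q w)
      ((fderiv ℝ (momentum (Function.uncurry ℓ)) p).flip w) p := by
  have h1 := (((h.contDiffAt_momentum hp).differentiableAt (by simp)).hasFDerivAt).clm_apply
    (hasFDerivAt_const w p)
  refine h1.congr_fderiv ?_
  ext <;> simp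

lemma hasFDerivAt_fiberMetric_apply (h : IsSmoothLagrangian (Function.uncurry ℓ) U)
    {p : EuclideanSpace ℝ (Fin n) × EuclideanSpace ℝ (Fin n)} (hp : p ∈ U)
    (v w : EuclideanSpace ℝ (Fin n)) :
    HasFDerivAt (fun q => fiberMetric (Function.uncurry ℓ) q v w)
      (((fderiv ℝ (fiberMetric (Function.uncurry ℓ)) p).flip v).flip w) p := by
  have h1 := ((((h.contDiffAt_fiberMetric hp).differentiableAt (by simp)).hasFDerivAt).clm_apply
    (hasFDerivAt_const v p)).clm_apply (hasFDerivAt_const w p)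
  refine h1.congr_fderiv ?_
  ext <;> simp

lemma vertHessian_apply (h : IsSmoothLagrangian (Function.uncurry ℓ) U)
    {p : EuclideanSpace ℝ (Fin n) × EuclideanSpace ℝ (Fin n)} (hp : p ∈ U) (i j : Fin n) :
    vertHessian ℓ p.1 p.2 i j
      = fiberMetric (Function.uncurry ℓ) p (coordVec i) (coordVec j) := by
  have h1 := h.hasFDerivAt_momentum_apply hp (coordVec j)
  change dy i (dy j ℓ) p.1 p.2 = _
  rw [dy_eq_fderiv (h.eventuallyEq_of_eqOn (h.dy_eq j) hp) h1.differentiableAt, h1.fderiv]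
  simp [fiberMetric]

lemma sum_vertHessian_mul (h : IsSmoothLagrangian (Function.uncurry ℓ) U)
    {p : EuclideanSpace ℝ (Fin n) × EuclideanSpace ℝ (Fin n)} (hp : p ∈ U)
    (u : EuclideanSpace ℝ (Fin n)) (l : Fin n) :
    ∑ i, vertHessian ℓ p.1 p.2 l i * u i = fiberMetric (Function.uncurry ℓ) p u (coordVec l) := by
  conv_rhs => rw [h.fiberMetric_symm hp, ← sum_smul_coordVec u, map_sum]
  exact Finset.sum_congr rfl fun i _ => by
    rw [h.vertHessian_apply hp, map_smul, smul_eq_mul, mul_comm]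

lemma isRegularLagrangian (h : IsSmoothLagrangian (Function.uncurry ℓ) U)
    (hdet : ∀ p ∈ U, IsUnit (vertHessian ℓ p.1 p.2).det) :
    IsRegularLagrangian (Function.uncurry ℓ) U where
  toIsSmoothLagrangian := h
  nondegenerate p hp v hv := by
    have h0 : (vertHessian ℓ p.1 p.2).mulVec (WithLp.ofLp v) = 0 := by
      funext l
      simpa [Matrix.mulVec, dotProduct, hv] using h.sum_vertHessian_mul hp v l
    have h1 := Matrix.eq_zero_of_mulVec_eq_zero (isUnit_iff_ne_zero.1 (hdet p hp)) h0
    ext i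
    simpa using congrFun h1 i

/-- The coordinate formula for the spray coefficients defines the spray. -/
lemma isSprayOf_sprayVec (h : IsSmoothLagrangian (Function.uncurry ℓ) U)
    (hdet : ∀ p ∈ U, IsUnit (vertHessian ℓ p.1 p.2).det) :
    IsSprayOf (sprayVec ℓ) (Function.uncurry ℓ) U := by
  intro p hp w
  have hEuler : ∀ l, (∑ j, p.2 j * dx j (dy l ℓ) p.1 p.2) - dx l ℓ p.1 p.2
      = eulerForm (Function.uncurry ℓ) p (coordVec l) := by
    intro l
    have h1 := h.hasFDerivAt_momentum_apply hp (coordVec l)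
    have h2 : ∀ j, dx j (dy l ℓ) p.1 p.2
        = fderiv ℝ (momentum (Function.uncurry ℓ)) p (coordVec j, 0) (coordVec l) := fun j => by
      rw [dx_eq_fderiv (h.eventuallyEq_of_eqOn (h.dy_eq l) hp) h1.differentiableAt, h1.fderiv,
        ContinuousLinearMap.flip_apply]
    have h3 : ((p.2, 0) : EuclideanSpace ℝ (Fin n) × EuclideanSpace ℝ (Fin n))
        = ∑ j, p.2 j • (coordVec j, 0) := by
      conv_lhs => rw [← sum_smul_coordVec p.2]
      rw [Prod.ext_iff]
      simp [Prod.fst_sum, Prod.snd_sum]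
    rw [dx_eq_fderiv (Filter.EventuallyEq.refl _ _)
      ((h.contDiffAt hp).differentiableAt (by simp)), eulerForm, h3, map_sum]
    simp only [map_smul, sub_apply, sum_apply, smul_apply, smul_eq_mul, h2]
    simp
  induction w using coordVec_induction with
  | single l =>
    rw [← h.sum_vertHessian_mul hp, ← hEuler]
    exact sum_mul_inv_mul (hdet p hp) _ l
  | zero => simp
  | add u v hu hv => rw [map_add, map_add, hu, hv]
  | smul a u hu => rw [map_smul, map_smul, hu]

/-- `δ/δx^j` is differentiation along the horizontal lift of the `j`-th basis vector, whose vertical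
components are `-N^k_j`. -/
lemma hderiv_apply (h : IsSmoothLagrangian (Function.uncurry ℓ) U)
    (hdet : ∀ p ∈ U, IsUnit (vertHessian ℓ p.1 p.2).det)
    {f : EuclideanSpace ℝ (Fin n) → EuclideanSpace ℝ (Fin n) → ℝ}
    {g : EuclideanSpace ℝ (Fin n) × EuclideanSpace ℝ (Fin n) → ℝ}
    {p : EuclideanSpace ℝ (Fin n) × EuclideanSpace ℝ (Fin n)} (hp : p ∈ U)
    (hfg : Set.EqOn (Function.uncurry f) g U) (hg : DifferentiableAt ℝ g p) (j : Fin n) :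
    hderiv ℓ j f p.1 p.2 = fderiv ℝ g p (horizontalLift (sprayVec ℓ) p (coordVec j)) := by
  have hS : HasFDerivAt (sprayVec ℓ) (fderiv ℝ (sprayVec ℓ) p) p :=
    (((h.isRegularLagrangian hdet).contDiffAt_spray (h.isSprayOf_sprayVec hdet)
      hp).differentiableAt (by simp)).hasFDerivAt
  have hN : ∀ k, nonlinConn ℓ k j p.1 p.2
      = 1 / 2 * fderiv ℝ (sprayVec ℓ) p (0, coordVec j) k := by
    intro k
    have h1 : HasFDerivAt (fun q => sprayVec ℓ q k)
        ((EuclideanSpace.proj k : EuclideanSpace ℝ (Fin n) →L[ℝ] ℝ).comp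
          (fderiv ℝ (sprayVec ℓ) p)) p :=
      (EuclideanSpace.proj k : EuclideanSpace ℝ (Fin n) →L[ℝ] ℝ).hasFDerivAt.comp p hS
    rw [nonlinConn, dy_eq_fderiv (Filter.EventuallyEq.refl _ _) h1.differentiableAt]
    congr 1
    change fderiv ℝ (fun q => sprayVec ℓ q k) p _ = _
    rw [h1.fderiv]
    simp
  have hE := h.eventuallyEq_of_eqOn hfg hp
  have hlift : horizontalLift (sprayVec ℓ) p (coordVec j)
      = (coordVec j, 0) - ∑ k, nonlinConn ℓ k j p.1 p.2 • (0, coordVec k) := by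
    rw [Prod.ext_iff]
    constructor
    · simp [horizontalLift, Prod.fst_sum]
    · have := sum_smul_coordVec ((1 / 2 : ℝ) • fderiv ℝ (sprayVec ℓ) p (0, coordVec j))
      simp only [PiLp.smul_apply, smul_eq_mul, ← hN] at this
      simp only [Prod.snd_sub, Prod.snd_sum, Prod.smul_snd, this]
      simp [horizontalLift]
  rw [hderiv, dx_eq_fderiv hE hg, hlift, map_sub, map_sum]
  simp only [map_smul, smul_eq_mul, dy_eq_fderiv hE hg]

/-- The coordinate formula for the Chern connection raises the index of the Christoffel symbols of
the first kind. -/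
lemma fiberMetric_chernVec (h : IsSmoothLagrangian (Function.uncurry ℓ) U)
    (hdet : ∀ p ∈ U, IsUnit (vertHessian ℓ p.1 p.2).det)
    {p : EuclideanSpace ℝ (Fin n) × EuclideanSpace ℝ (Fin n)} (hp : p ∈ U) (j k : Fin n)
    (w : EuclideanSpace ℝ (Fin n)) :
    fiberMetric (Function.uncurry ℓ) p (chernVec ℓ j k p) w
      = christoffelForm (Function.uncurry ℓ) (sprayVec ℓ) p (coordVec j) (coordVec k) w := by
  have hH : ∀ i a b, hderiv ℓ i (fun u v => vertHessian ℓ u v a b) p.1 p.2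
      = fderiv ℝ (fiberMetric (Function.uncurry ℓ)) p
          (horizontalLift (sprayVec ℓ) p (coordVec i)) (coordVec a) (coordVec b) := by
    intro i a b
    have h1 := h.hasFDerivAt_fiberMetric_apply hp (coordVec a) (coordVec b)
    rw [h.hderiv_apply (f := fun u v => vertHessian ℓ u v a b) hdet hp
      (fun q hq => h.vertHessian_apply hq a b) h1.differentiableAt,
      h1.fderiv]
    simp
  induction w using coordVec_induction with
  | single l =>
    rw [← h.sum_vertHessian_mul hp]
    simp only [chernVec, chern, hH]
    have := sum_mul_inv_mul (hdet p hp) (fun m => christoffelForm (Function.uncurry ℓ) (sprayVec ℓ)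
      p (coordVec j) (coordVec k) (coordVec m)) l
    rw [← this]
    refine Finset.sum_congr rfl fun i _ => ?_
    congr 1
    rw [Finset.mul_sum]
    refine Finset.sum_congr rfl fun m _ => ?_
    rw [christoffelForm]
    ring
  | zero => simp [christoffelForm]
  | add u v hu hv =>
    rw [map_add, hu, hv]
    simp only [christoffelForm, map_add, add_apply]
    ring
  | smul a u hu =>
    rw [map_smul, hu]
    simp only [christoffelForm, map_smul, smul_apply, smul_eq_mul]
    ring

/-- The form is linear in `u` and `v`, so basis vectors suffice there; on them it is the metric
paired with the vector of Chern coefficients. -/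
lemma christoffelForm_eq_zero (h : IsSmoothLagrangian (Function.uncurry ℓ) U)
    (hdet : ∀ p ∈ U, IsUnit (vertHessian ℓ p.1 p.2).det)
    {p : EuclideanSpace ℝ (Fin n) × EuclideanSpace ℝ (Fin n)} (hp : p ∈ U)
    (hΓ : ∀ i j k, chern ℓ i j k p.1 p.2 = 0) (u v w : EuclideanSpace ℝ (Fin n)) :
    christoffelForm (Function.uncurry ℓ) (sprayVec ℓ) p u v w = 0 := by
  have h0 : ∀ j k, chernVec ℓ j k p = 0 := fun j k => by
    ext i
    simpa [chernVec] using hΓ i j k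
  induction u using coordVec_induction with
  | single j =>
    induction v using coordVec_induction with
    | single k => simp [← h.fiberMetric_chernVec hdet hp, h0]
    | zero => simp [christoffelForm]
    | add a b ha hb =>
      simp only [christoffelForm, map_add, add_apply] at ha hb ⊢
      linarith
    | smul c a ha =>
      simp only [christoffelForm, map_smul, smul_apply, smul_eq_mul] at ha ⊢
      linear_combination c * ha
  | zero => simp [christoffelForm]
  | add a b ha hb =>
    simp only [christoffelForm, map_add, add_apply] at ha hb ⊢
    linarith
  | smul c a ha =>
    simp only [christoffelForm, map_smul, smul_apply, smul_eq_mul] at ha ⊢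
    linear_combination c * ha

end IsSmoothLagrangian

/-- If the Chern connection vanishes on a fibre in one system of coordinates, then in any other
system of coordinates it does not depend on the velocity. -/
lemma IsLagrangianChange.chern_eq_of_chern_eq_zero
    {ℓ' : EuclideanSpace ℝ (Fin n) → EuclideanSpace ℝ (Fin n) → ℝ}
    {U' : Set (EuclideanSpace ℝ (Fin n) × EuclideanSpace ℝ (Fin n))}
    {φ : EuclideanSpace ℝ (Fin n) → EuclideanSpace ℝ (Fin n)}
    {W : Set (EuclideanSpace ℝ (Fin n))}
    (hφ : IsLagrangianChange φ W (Function.uncurry ℓ) U (Function.uncurry ℓ') U')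
    (h : IsSmoothLagrangian (Function.uncurry ℓ) U)
    (hdet : ∀ p ∈ U, IsUnit (vertHessian ℓ p.1 p.2).det)
    (h' : IsSmoothLagrangian (Function.uncurry ℓ') U')
    (hdet' : ∀ p ∈ U', IsUnit (vertHessian ℓ' p.1 p.2).det)
    {x : EuclideanSpace ℝ (Fin n)} (hx : x ∈ W)
    (hΓ : ∀ y, (φ x, y) ∈ U' → ∀ i j k, chern ℓ' i j k (φ x) y = 0)
    {y₁ y₂ : EuclideanSpace ℝ (Fin n)} (h₁ : (x, y₁) ∈ U) (h₂ : (x, y₂) ∈ U) (i j k : Fin n) :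
    chern ℓ i j k x y₁ = chern ℓ i j k x y₂ := by
  -- `a` plays the role of `(Dφ)⁻¹ D²φ(e_j, e_k)` and is chosen from `x` alone. Both velocities are
  -- compared with it directly, so the fibre of admissible directions need not be connected.
  obtain ⟨a, ha⟩ := hφ.surjective x hx (fderiv ℝ (fderiv ℝ φ) x (coordVec j) (coordVec k))
  have key : ∀ y, (x, y) ∈ U → chernVec ℓ j k (x, y) = a := by
    intro y hy
    have hr := h.isRegularLagrangian hdet
    have hr' := h'.isRegularLagrangian hdet'
    refine hr.eq_of_fiberMetric_eq hy fun w => ?_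
    rw [h.fiberMetric_chernVec hdet hy, hφ.christoffelForm_apply hr hr'
      (h.isSprayOf_sprayVec hdet) (h'.isSprayOf_sprayVec hdet') hy hx,
      h'.christoffelForm_eq_zero hdet' (hφ.mapsTo _ hy hx)
        (hΓ _ (hφ.mapsTo _ hy hx)), hφ.fiberMetric_apply hr hr' hy hx, ha, zero_add]
  have := congrArg (fun v : EuclideanSpace ℝ (Fin n) => v i)
    ((key y₁ h₁).trans (key y₂ h₂).symm)
  simpa [chernVec] using this

/-- The covariant derivatives of the `hv`-curvature vanish where the Chern connection does not
depend on the velocity. -/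
lemma covP_eq_zero (hU : IsOpen U)
    (hΓ : ∀ x y₁ y₂, (x, y₁) ∈ U → (x, y₂) ∈ U → ∀ i j k, chern ℓ i j k x y₁ = chern ℓ i j k x y₂)
    {x y : EuclideanSpace ℝ (Fin n)} (hxy : (x, y) ∈ U) (τ μ ν ρ σ : Fin n) :
    hcovP ℓ τ μ ν ρ σ x y = 0 ∧ vcovP ℓ τ μ ν ρ σ x y = 0 := by
  -- Vanishing on all of `U`, not just at `(x, y)`, is what allows `P` to be differentiated again.
  have hP : ∀ μ ν ρ σ, Set.EqOn (Function.uncurry (curvP ℓ μ ν ρ σ)) (fun _ => 0) U := by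
    rintro μ ν ρ σ ⟨x, y⟩ hxy
    have hE : (fun z => chern ℓ μ ν ρ x z) =ᶠ[𝓝 y] fun _ => chern ℓ μ ν ρ x y := by
      have hc : Filter.Tendsto (fun z : EuclideanSpace ℝ (Fin n) => (x, z)) (𝓝 y) (𝓝 (x, y)) :=
        (Continuous.prodMk_right x).tendsto y
      filter_upwards [hc.eventually (hU.mem_nhds hxy)] with z hz
      exact hΓ x z y hz hxy μ ν ρ
    rw [Function.uncurry_apply_pair, curvP, dy, hE.fderiv_eq, fderiv_const_apply, zero_apply]
  have hP0 : ∀ μ ν ρ σ, curvP ℓ μ ν ρ σ x y = 0 := fun μ ν ρ σ => by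
    simpa only [Function.uncurry_apply_pair] using hP μ ν ρ σ hxy
  have hE := (hP μ ν ρ σ).eventuallyEq_of_mem (hU.mem_nhds hxy)
  have hx : ∀ i, dx i (curvP ℓ μ ν ρ σ) x y = 0 := fun i => by
    have := dx_eq_fderiv hE (differentiableAt_const 0) i
    rwa [fderiv_const_apply, zero_apply] at this
  have hy : ∀ i, dy i (curvP ℓ μ ν ρ σ) x y = 0 := fun i => by
    have := dy_eq_fderiv hE (differentiableAt_const 0) i
    rwa [fderiv_const_apply, zero_apply] at this
  constructor
  · simp [hcovP, hderiv, hx, hy, hP0]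
  · rw [vcovP, hy]

end Coordinates

/-! ### Tangent vectors in charts -/

section Charts

variable {n : ℕ} {M : Type*} [TopologicalSpace M] [ChartedSpace (EuclideanSpace ℝ (Fin n)) M]

/-- The derivatives lie in fibres over `f p.1` and `g p.1`, so the base points have to be identified
as well; `key` does this. -/
lemma tangentMap_eq_of_eventuallyEq {𝕜 : Type*} [NontriviallyNormedField 𝕜]
    {E : Type*} [NormedAddCommGroup E] [NormedSpace 𝕜 E] {H : Type*} [TopologicalSpace H]
    {I : ModelWithCorners 𝕜 E H} {N : Type*} [TopologicalSpace N] [ChartedSpace H N]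
    {E' : Type*} [NormedAddCommGroup E'] [NormedSpace 𝕜 E'] {H' : Type*} [TopologicalSpace H']
    {I' : ModelWithCorners 𝕜 E' H'} {N' : Type*} [TopologicalSpace N'] [ChartedSpace H' N']
    {f g : N → N'} {p : TangentBundle I N} (h : f =ᶠ[𝓝 p.1] g) :
    tangentMap I I' f p = tangentMap I I' g p := by
  have key : ∀ (a b : N') (v : E'), a = b →
      (⟨a, v⟩ : TangentBundle I' N') = ⟨b, v⟩ := by
    rintro a b v rfl
    rfl
  simp only [tangentMap, h.mfderiv_eq]
  exact key _ _ _ h.eq_of_nhds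

lemma velocity_eq_of_eventuallyEq {c₁ c₂ : ℝ → M} {t : ℝ} (h : c₁ =ᶠ[𝓝 t] c₂) :
    velocity (n := n) c₁ t = velocity c₂ t :=
  tangentMap_eq_of_eventuallyEq (I := 𝓘(ℝ, ℝ)) (I' := 𝓡 n)
    (p := (⟨t, 1⟩ : TangentBundle 𝓘(ℝ, ℝ) ℝ)) h

variable {e e' : OpenPartialHomeomorph M (EuclideanSpace ℝ (Fin n))}

lemma contMDiffAt_chart [IsManifold (𝓡 n) ∞ M] (he : e ∈ IsManifold.maximalAtlas (𝓡 n) ∞ M)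
    {m : M} (hm : m ∈ e.source) : ContMDiffAt (𝓡 n) (𝓡 n) ∞ e m :=
  (contMDiffOn_of_mem_maximalAtlas he).contMDiffAt (e.open_source.mem_nhds hm)

lemma contMDiffAt_chart_symm [IsManifold (𝓡 n) ∞ M]
    (he : e ∈ IsManifold.maximalAtlas (𝓡 n) ∞ M) {x : EuclideanSpace ℝ (Fin n)}
    (hx : x ∈ e.target) : ContMDiffAt (𝓡 n) (𝓡 n) ∞ e.symm x :=
  (contMDiffOn_symm_of_mem_maximalAtlas he).contMDiffAt (e.open_target.mem_nhds hx)

variable [IsManifold (𝓡 n) ∞ M]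

/-- Chain rule for `e ∘ e.symm = id` near `x`. It provides the left inverse behind
`chartVec_injective`; the other composition gives `exists_chartVec_eq`. -/
lemma tangentMap_chartVec (he : e ∈ IsManifold.maximalAtlas (𝓡 n) ∞ M)
    {x : EuclideanSpace ℝ (Fin n)} (hx : x ∈ e.target) (y : EuclideanSpace ℝ (Fin n)) :
    tangentMap (𝓡 n) (𝓡 n) e (chartVec e x y)
      = (⟨x, y⟩ : TangentBundle (𝓡 n) (EuclideanSpace ℝ (Fin n))) := by
  have h1 := tangentMap_comp_at (I := 𝓡 n) (I' := 𝓡 n) (I'' := 𝓡 n) (f := e.symm) (g := e)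
    (⟨x, y⟩ : TangentBundle (𝓡 n) (EuclideanSpace ℝ (Fin n)))
    ((contMDiffAt_chart he (e.map_target hx)).mdifferentiableAt (by simp))
    ((contMDiffAt_chart_symm he hx).mdifferentiableAt (by simp))
  refine h1.symm.trans ?_
  have h2 : (e ∘ e.symm) =ᶠ[𝓝 x] id := by
    filter_upwards [e.open_target.mem_nhds hx] with z hz using e.right_inv hz
  rw [tangentMap_eq_of_eventuallyEq (I := 𝓡 n) (I' := 𝓡 n)
    (p := (⟨x, y⟩ : TangentBundle (𝓡 n) (EuclideanSpace ℝ (Fin n)))) h2, tangentMap_id]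
  rfl

lemma chartVec_injective (he : e ∈ IsManifold.maximalAtlas (𝓡 n) ∞ M)
    {x x' y y' : EuclideanSpace ℝ (Fin n)} (hx : x ∈ e.target) (hx' : x' ∈ e.target)
    (h : chartVec e x y = chartVec e x' y') : x = x' ∧ y = y' := by
  have h1 := (tangentMap_chartVec he hx y).symm.trans
    ((congrArg _ h).trans (tangentMap_chartVec he hx' y'))
  have h2 : x = x' := congrArg Bundle.TotalSpace.proj h1
  subst h2
  exact ⟨rfl, congrArg (fun q : TangentBundle (𝓡 n) (EuclideanSpace ℝ (Fin n)) =>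
    (q.2 : EuclideanSpace ℝ (Fin n))) h1⟩

lemma exists_chartVec_eq (he : e ∈ IsManifold.maximalAtlas (𝓡 n) ∞ M)
    {p : TangentBundle (𝓡 n) M} (hp : p.1 ∈ e.source) :
    ∃ y, chartVec e (e p.1) y = p := by
  refine ⟨(tangentMap (𝓡 n) (𝓡 n) e p).2, ?_⟩
  have h1 := tangentMap_comp_at (I := 𝓡 n) (I' := 𝓡 n) (I'' := 𝓡 n) (f := e) (g := e.symm) p
    ((contMDiffAt_chart_symm he (e.map_source hp)).mdifferentiableAt (by simp))
    ((contMDiffAt_chart he hp).mdifferentiableAt (by simp))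
  refine h1.symm.trans ?_
  have h2 : (e.symm ∘ e) =ᶠ[𝓝 p.1] id := by
    filter_upwards [e.open_source.mem_nhds hp] with z hz using e.left_inv hz
  rw [tangentMap_eq_of_eventuallyEq h2, tangentMap_id]
  rfl

/-- The tangent map of `e.symm`, after identifying `E × E` with the tangent bundle of `E`. It
transports the openness of `dom` and the smoothness of `L` to coordinates. -/
lemma contMDiffOn_chartVec (he : e ∈ IsManifold.maximalAtlas (𝓡 n) ∞ M) :
    ContMDiffOn 𝓘(ℝ, EuclideanSpace ℝ (Fin n) × EuclideanSpace ℝ (Fin n)) (𝓡 n).tangent ∞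
      (fun p : EuclideanSpace ℝ (Fin n) × EuclideanSpace ℝ (Fin n) => chartVec e p.1 p.2)
      (e.target ×ˢ Set.univ) := by
  have h1 : ContMDiff 𝓘(ℝ, EuclideanSpace ℝ (Fin n) × EuclideanSpace ℝ (Fin n)) (𝓡 n).tangent ∞
      (fun p : EuclideanSpace ℝ (Fin n) × EuclideanSpace ℝ (Fin n) =>
        (⟨p.1, p.2⟩ : TangentBundle (𝓡 n) (EuclideanSpace ℝ (Fin n)))) := by
    intro p
    rw [Bundle.contMDiffAt_totalSpace]
    exact ⟨contDiffAt_fst.contMDiffAt, by simpa using contDiffAt_snd.contMDiffAt⟩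
  have h2 := (contMDiffOn_symm_of_mem_maximalAtlas he).contMDiffOn_tangentMapWithin (m := ∞)
    (by simp) e.open_target.uniqueMDiffOn
  refine (h2.comp h1.contMDiffOn (fun p hp => hp.1)).congr fun p hp => ?_
  exact (tangentMapWithin_eq_tangentMap (I := 𝓡 n) (I' := 𝓡 n)
    (p := (⟨p.1, p.2⟩ : TangentBundle (𝓡 n) (EuclideanSpace ℝ (Fin n))))
    (e.open_target.uniqueMDiffOn p.1 hp.1)
    ((contMDiffAt_chart_symm he hp.1).mdifferentiableAt (by simp))).symm

lemma contDiffAt_transition (he : e ∈ IsManifold.maximalAtlas (𝓡 n) ∞ M)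
    (he' : e' ∈ IsManifold.maximalAtlas (𝓡 n) ∞ M) {x : EuclideanSpace ℝ (Fin n)}
    (hx : x ∈ (e.symm.trans e').source) : ContDiffAt ℝ ∞ (e.symm.trans e') x := by
  rw [e.symm.trans_source] at hx
  exact ((contMDiffAt_chart he' hx.2).comp x (contMDiffAt_chart_symm he hx.1)).contDiffAt

lemma chartVec_transition (he : e ∈ IsManifold.maximalAtlas (𝓡 n) ∞ M)
    (he' : e' ∈ IsManifold.maximalAtlas (𝓡 n) ∞ M) {x : EuclideanSpace ℝ (Fin n)}
    (hx : x ∈ (e.symm.trans e').source) (y : EuclideanSpace ℝ (Fin n)) :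
    chartVec e' (e.symm.trans e' x) (fderiv ℝ (e.symm.trans e') x y) = chartVec e x y := by
  have hx' := (e.symm.trans e').map_source hx
  rw [e.symm.trans_target] at hx'
  have h1 := tangentMap_comp_at (I := 𝓡 n) (I' := 𝓡 n) (I'' := 𝓡 n) (f := e.symm.trans e')
    (g := e'.symm) (⟨x, y⟩ : TangentBundle (𝓡 n) (EuclideanSpace ℝ (Fin n)))
    ((contMDiffAt_chart_symm he' hx'.1).mdifferentiableAt (by simp))
    ((contDiffAt_transition he he' hx).contMDiffAt.mdifferentiableAt (by simp))
  have h2 : (e'.symm ∘ (e.symm.trans e')) =ᶠ[𝓝 x] e.symm := by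
    filter_upwards [(e.symm.trans e').open_source.mem_nhds hx] with z hz
    rw [e.symm.trans_source] at hz
    exact e'.left_inv hz.2
  rw [tangentMap_eq_of_eventuallyEq (I := 𝓡 n) (I' := 𝓡 n)
    (p := (⟨x, y⟩ : TangentBundle (𝓡 n) (EuclideanSpace ℝ (Fin n)))) h2] at h1
  refine Eq.trans ?_ h1.symm
  simp only [tangentMap, mfderiv_eq_fderiv]
  rfl

/-- A tangent vector given by components in `e'` also has components in `e`, and these form a
preimage. -/
lemma surjective_fderiv_transition (he : e ∈ IsManifold.maximalAtlas (𝓡 n) ∞ M)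
    (he' : e' ∈ IsManifold.maximalAtlas (𝓡 n) ∞ M) {x : EuclideanSpace ℝ (Fin n)}
    (hx : x ∈ (e.symm.trans e').source) :
    Function.Surjective (fderiv ℝ (e.symm.trans e') x) := by
  intro y'
  have hx' := (e.symm.trans e').map_source hx
  rw [e.symm.trans_source] at hx
  rw [e.symm.trans_target] at hx'
  have hsymm : e'.symm (e.symm.trans e' x) = e.symm x := e'.left_inv hx.2
  obtain ⟨y, hy⟩ := exists_chartVec_eq he (p := chartVec e' (e.symm.trans e' x) y')
    (show e'.symm (e.symm.trans e' x) ∈ e.source from hsymm ▸ e.map_target hx.1)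
  have h1 : e (chartVec e' (e.symm.trans e' x) y').1 = x := by
    change e (e'.symm (e.symm.trans e' x)) = x
    rw [hsymm, e.right_inv hx.1]
  rw [h1] at hy
  refine ⟨y, ?_⟩
  rw [← chartVec_transition he he' (by rwa [e.symm.trans_source])] at hy
  exact (chartVec_injective he' hx'.1 hx'.1 hy).2

lemma velocity_eq_chartVec (he : e ∈ IsManifold.maximalAtlas (𝓡 n) ∞ M) {c : ℝ → M} {t : ℝ}
    (hc : MDifferentiableAt 𝓘(ℝ, ℝ) (𝓡 n) c t) (ht : c t ∈ e.source) :
    velocity c t = chartVec e (e (c t)) (deriv (fun s => e (c s)) t) := by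
  have hec : MDifferentiableAt 𝓘(ℝ, ℝ) (𝓡 n) (fun s => e (c s)) t :=
    ((contMDiffAt_chart he ht).mdifferentiableAt (by simp)).comp t hc
  have h1 := tangentMap_comp_at (I := 𝓘(ℝ, ℝ)) (I' := 𝓡 n) (I'' := 𝓡 n)
    (f := fun s => e (c s)) (g := e.symm) (⟨t, 1⟩ : TangentBundle 𝓘(ℝ, ℝ) ℝ)
    ((contMDiffAt_chart_symm he (e.map_source ht)).mdifferentiableAt (by simp)) hec
  have h2 : (e.symm ∘ fun s => e (c s)) =ᶠ[𝓝 t] c := by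
    filter_upwards [hc.continuousAt.preimage_mem_nhds (e.open_source.mem_nhds ht)] with s hs
    exact e.left_inv hs
  rw [tangentMap_eq_of_eventuallyEq (I := 𝓘(ℝ, ℝ)) (I' := 𝓡 n)
    (p := (⟨t, 1⟩ : TangentBundle 𝓘(ℝ, ℝ) ℝ)) h2] at h1
  refine Eq.trans h1 ?_
  simp only [tangentMap, mfderiv_eq_fderiv]
  rfl

end Charts

/-! ### Finsler space-times in charts -/

namespace FinslerSpacetime

variable {n : ℕ} {M : Type*} [TopologicalSpace M] [ChartedSpace (EuclideanSpace ℝ (Fin n)) M]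
  [IsManifold (𝓡 n) ∞ M] (F : FinslerSpacetime n M)
  {e e' : OpenPartialHomeomorph M (EuclideanSpace ℝ (Fin n))}

/-- The admissible directions in the coordinates of the chart `e`. -/
def localDom (e : OpenPartialHomeomorph M (EuclideanSpace ℝ (Fin n))) :
    Set (EuclideanSpace ℝ (Fin n) × EuclideanSpace ℝ (Fin n)) :=
  {p | p.1 ∈ e.target ∧ chartVec e p.1 p.2 ∈ F.dom}

lemma isSmoothLagrangian_localL (he : e ∈ IsManifold.maximalAtlas (𝓡 n) ∞ M) :
    IsSmoothLagrangian (Function.uncurry (F.localL e)) (F.localDom e) := by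
  have hsub : F.localDom e ⊆ e.target ×ˢ Set.univ := fun p hp => ⟨hp.1, trivial⟩
  refine ⟨?_, ?_⟩
  · have := (contMDiffOn_chartVec he).continuousOn.isOpen_inter_preimage
      (e.open_target.prod isOpen_univ) F.isOpen_dom
    convert this using 1
    ext p
    simp [localDom]
  · exact (F.smooth.comp ((contMDiffOn_chartVec he).mono hsub) fun p hp => hp.2).contDiffOn

lemma isUnit_det_vertHessian (he : e ∈ IsManifold.maximalAtlas (𝓡 n) ∞ M) :
    ∀ p ∈ F.localDom e, IsUnit (vertHessian (F.localL e) p.1 p.2).det :=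
  fun p hp => (F.lorentzian e he p.1 hp.1 p.2 hp.2).isUnit_det

lemma isLagrangianChange_transition (he : e ∈ IsManifold.maximalAtlas (𝓡 n) ∞ M)
    (he' : e' ∈ IsManifold.maximalAtlas (𝓡 n) ∞ M) :
    IsLagrangianChange (e.symm.trans e') (e.symm.trans e').source
      (Function.uncurry (F.localL e)) (F.localDom e)
      (Function.uncurry (F.localL e')) (F.localDom e') where
  isOpen := (e.symm.trans e').open_source
  contDiffOn x hx := (contDiffAt_transition he he' hx).contDiffWithinAt
  surjective x hx := surjective_fderiv_transition he he' hx
  mapsTo p hp hx := by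
    refine ⟨?_, ?_⟩
    · have := (e.symm.trans e').map_source hx
      rw [e.symm.trans_target] at this
      exact this.1
    · have := hp.2
      rwa [← chartVec_transition he he' hx] at this
  eq_comp p hp hx := by
    change F.L (chartVec e p.1 p.2) = F.L (chartVec e' _ _)
    rw [← chartVec_transition he he' hx]
    rfl

variable {F}

/-- In Einstein's equivalence principle the connection coefficients have to vanish in some chart on
the fibre over each event, hence they depend on the position only. -/
lemma EinsteinEquivalencePrinciple.nablaPVanishes (h : F.EinsteinEquivalencePrinciple) :
    F.NablaPVanishes := by
  intro e he x hx y hxy τ μ ν ρ σ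
  refine covP_eq_zero (U := F.localDom e) (F.isSmoothLagrangian_localL he).isOpen ?_ ⟨hx, hxy⟩ ..
  intro x y₁ y₂ h₁ h₂ i j k
  -- A single geodesic through the event is enough, here with velocity `y₁`: its freely falling
  -- chart makes `Γ` vanish for every admissible velocity over the event, including `y₂`.
  obtain ⟨⟨X, a, b, h0, hX, hX0⟩, -⟩ := h.1 _ h₁.2 0
  obtain ⟨e', he', hs, hΓ, -⟩ := h.2 X a b hX 0 h0
  have hX0' : X 0 = e.symm x := congrArg Bundle.TotalSpace.proj hX0
  have hφx : e.symm.trans e' x = e' (X 0) := by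
    rw [hX0']
    rfl
  refine (F.isLagrangianChange_transition he he').chern_eq_of_chern_eq_zero
    (F.isSmoothLagrangian_localL he) (F.isUnit_det_vertHessian he)
    (F.isSmoothLagrangian_localL he') (F.isUnit_det_vertHessian he') (x := x) ?_ ?_ h₁ h₂ i j k
  · rw [e.symm.trans_source]
    exact ⟨h₁.1, show e.symm x ∈ e'.source from hX0' ▸ hs⟩
  · intro y' hy'
    rw [hφx] at hy' ⊢
    exact hΓ.self_of_nhds y' hy'.2

/-! ### Existence and uniqueness of geodesics -/

/-- The geodesic vector field in the coordinates of the chart `e`. -/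
def geodesicField (F : FinslerSpacetime n M)
    (e : OpenPartialHomeomorph M (EuclideanSpace ℝ (Fin n)))
    (p : EuclideanSpace ℝ (Fin n) × EuclideanSpace ℝ (Fin n)) :
    EuclideanSpace ℝ (Fin n) × EuclideanSpace ℝ (Fin n) :=
  (p.2, -sprayVec (F.localL e) p)

lemma contDiffAt_geodesicField (he : e ∈ IsManifold.maximalAtlas (𝓡 n) ∞ M)
    {p : EuclideanSpace ℝ (Fin n) × EuclideanSpace ℝ (Fin n)} (hp : p ∈ F.localDom e) :
    ContDiffAt ℝ ∞ (F.geodesicField e) p :=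
  contDiffAt_snd.prodMk (((F.isSmoothLagrangian_localL he).isRegularLagrangian
    (F.isUnit_det_vertHessian he)).contDiffAt_spray
      ((F.isSmoothLagrangian_localL he).isSprayOf_sprayVec (F.isUnit_det_vertHessian he)) hp).neg

namespace IsGeodesicOn

variable {c : ℝ → M} {I : Set ℝ}

lemma contMDiffAt (h : F.IsGeodesicOn c I) (hI : IsOpen I) {t : ℝ} (ht : t ∈ I) :
    ContMDiffAt 𝓘(ℝ, ℝ) (𝓡 n) 2 c t :=
  h.1.contMDiffAt (hI.mem_nhds ht)

lemma contDiffAt_comp (h : F.IsGeodesicOn c I) (hI : IsOpen I)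
    (he : e ∈ IsManifold.maximalAtlas (𝓡 n) ∞ M) {t : ℝ} (ht : t ∈ I) (hs : c t ∈ e.source) :
    ContDiffAt ℝ 2 (fun s => e (c s)) t :=
  (((contMDiffAt_chart he hs).of_le ENat.LEInfty.out).comp t (h.contMDiffAt hI ht)).contDiffAt

lemma contDiffAt_deriv_comp (h : F.IsGeodesicOn c I) (hI : IsOpen I)
    (he : e ∈ IsManifold.maximalAtlas (𝓡 n) ∞ M) {t : ℝ} (ht : t ∈ I) (hs : c t ∈ e.source) :
    ContDiffAt ℝ 1 (deriv fun s => e (c s)) t :=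
  ((h.contDiffAt_comp hI he ht hs).fderiv_right (m := 1) (by norm_num)).clm_apply contDiffAt_const

lemma velocity_eq (h : F.IsGeodesicOn c I) (hI : IsOpen I)
    (he : e ∈ IsManifold.maximalAtlas (𝓡 n) ∞ M) {t : ℝ} (ht : t ∈ I) (hs : c t ∈ e.source) :
    velocity c t = chartVec e (e (c t)) (deriv (fun s => e (c s)) t) :=
  velocity_eq_chartVec he ((h.contMDiffAt hI ht).mdifferentiableAt (by simp)) hs

lemma mem_localDom (h : F.IsGeodesicOn c I) (hI : IsOpen I)
    (he : e ∈ IsManifold.maximalAtlas (𝓡 n) ∞ M) {t : ℝ} (ht : t ∈ I) (hs : c t ∈ e.source) :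
    (e (c t), deriv (fun s => e (c s)) t) ∈ F.localDom e :=
  ⟨e.map_source hs, h.velocity_eq hI he ht hs ▸ h.2.1 t ht⟩

/-- The lift of a geodesic is an integral curve of the geodesic vector field. -/
lemma hasDerivAt_lift (h : F.IsGeodesicOn c I) (hI : IsOpen I)
    (he : e ∈ IsManifold.maximalAtlas (𝓡 n) ∞ M) {t : ℝ} (ht : t ∈ I) (hs : c t ∈ e.source) :
    HasDerivAt (fun s => (e (c s), deriv (fun s => e (c s)) s))
      (F.geodesicField e (e (c t), deriv (fun s => e (c s)) t)) t := by
  have h1 : HasDerivAt (fun s => e (c s)) (deriv (fun s => e (c s)) t) t :=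
    ((h.contDiffAt_comp hI he ht hs).differentiableAt (by simp)).hasDerivAt
  have h2 : HasDerivAt (deriv fun s => e (c s)) (deriv (deriv fun s => e (c s)) t) t :=
    ((h.contDiffAt_deriv_comp hI he ht hs).differentiableAt (by simp)).hasDerivAt
  have h3 : deriv (deriv fun s => e (c s)) t
      = -sprayVec (F.localL e) (e (c t), deriv (fun s => e (c s)) t) := by
    ext i
    have := h.2.2 e he t ht hs i
    simp only [sprayVec, PiLp.neg_apply]
    linarith
  rw [h3] at h2
  exact h1.prodMk h2

lemma eventually_mem_source (h : F.IsGeodesicOn c I) (hI : IsOpen I) {t : ℝ} (ht : t ∈ I)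
    (hs : c t ∈ e.source) : ∀ᶠ s in 𝓝 t, s ∈ I ∧ c s ∈ e.source :=
  Filter.Eventually.and (hI.mem_nhds ht)
    ((h.contMDiffAt hI ht).continuousAt.preimage_mem_nhds (e.open_source.mem_nhds hs))

/-- Geodesics with the same velocity at a parameter coincide near that parameter. -/
lemma eventuallyEq {c₁ c₂ : ℝ → M} (h₁ : F.IsGeodesicOn c₁ I) (h₂ : F.IsGeodesicOn c₂ I)
    (hI : IsOpen I) {t : ℝ} (ht : t ∈ I) (hv : velocity (n := n) c₁ t = velocity c₂ t) :
    c₁ =ᶠ[𝓝 t] c₂ := by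
  set e := chartAt (EuclideanSpace ℝ (Fin n)) (c₁ t)
  have he : e ∈ IsManifold.maximalAtlas (𝓡 n) ∞ M := IsManifold.chart_mem_maximalAtlas _
  have hs₁ : c₁ t ∈ e.source := mem_chart_source _ _
  have hs₂ : c₂ t ∈ e.source := by
    rwa [← show c₁ t = c₂ t from congrArg Bundle.TotalSpace.proj hv]
  have hv' := chartVec_injective he (e.map_source hs₁) (e.map_source hs₂)
    (((h₁.velocity_eq hI he ht hs₁).symm.trans hv).trans (h₂.velocity_eq hI he ht hs₂))
  -- A `C¹` field is Lipschitz near the common initial point, as the uniqueness theorem for ODEs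
  -- requires.
  obtain ⟨K, s, hs, hK⟩ := ((contDiffAt_geodesicField he
    (h₁.mem_localDom hI he ht hs₁)).of_le (m := 1) ENat.LEInfty.out).exists_lipschitzOnWith
  have hev : ∀ c : ℝ → M, F.IsGeodesicOn c I → c t ∈ e.source →
      s ∈ 𝓝 (e (c t), deriv (fun s => e (c s)) t) →
      ∀ᶠ τ in 𝓝 t, HasDerivAt (fun s => (e (c s), deriv (fun s => e (c s)) s))
        (F.geodesicField e (e (c τ), deriv (fun s => e (c s)) τ)) τ
        ∧ (e (c τ), deriv (fun s => e (c s)) τ) ∈ s := by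
    intro c hc hcs hsc
    filter_upwards [hc.eventually_mem_source hI ht hcs,
      (hc.hasDerivAt_lift hI he ht hcs).continuousAt.preimage_mem_nhds hsc] with τ hτ hτs
    exact ⟨hc.hasDerivAt_lift hI he hτ.1 hτ.2, hτs⟩
  have heq := ODE_solution_unique_of_eventually (v := fun _ => F.geodesicField e) (s := fun _ => s)
    (Filter.Eventually.of_forall fun _ => hK) (hev c₁ h₁ hs₁ hs)
    (hev c₂ h₂ hs₂ (by rwa [← hv'.1, ← hv'.2])) (Prod.ext hv'.1 hv'.2)
  filter_upwards [heq, h₁.eventually_mem_source hI ht hs₁, h₂.eventually_mem_source hI ht hs₂]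
    with τ hτ hτ₁ hτ₂
  exact e.injOn hτ₁.2 hτ₂.2 (congrArg Prod.fst hτ)

/-- Geodesics with the same velocity at a parameter of a common open interval coincide. -/
lemma eqOn_Ioo [T2Space M] {c₁ c₂ : ℝ → M} {a b t₀ : ℝ} (h₁ : F.IsGeodesicOn c₁ (Set.Ioo a b))
    (h₂ : F.IsGeodesicOn c₂ (Set.Ioo a b)) (ht₀ : t₀ ∈ Set.Ioo a b)
    (hv : velocity (n := n) c₁ t₀ = velocity c₂ t₀) : Set.EqOn c₁ c₂ (Set.Ioo a b) := by
  have hI : IsOpen (Set.Ioo a b) := isOpen_Ioo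
  -- Connectedness of the interval: the set of equal velocities is open by local uniqueness and
  -- relatively closed by continuity.
  suffices hsub : Set.Ioo a b ⊆ {t ∈ Set.Ioo a b | velocity (n := n) c₁ t = velocity c₂ t} from
    fun t ht => congrArg Bundle.TotalSpace.proj (hsub ht).2
  refine isPreconnected_Ioo.subset_of_closure_inter_subset ?_ ⟨t₀, ht₀, ht₀, hv⟩ ?_
  · rw [isOpen_iff_mem_nhds]
    rintro t ⟨ht, hvt⟩
    filter_upwards [hI.mem_nhds ht, (h₁.eventuallyEq h₂ hI ht hvt).eventually_nhds] with s hs hs'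
    exact ⟨hs, velocity_eq_of_eventuallyEq hs'⟩
  · rintro t ⟨htc, ht⟩
    refine ⟨ht, ?_⟩
    rw [mem_closure_iff_frequently] at htc
    -- Limits in `M` are unique by the Hausdorff property. Once the positions agree, one chart
    -- contains both points and the velocities are compared there as limits in coordinates.
    have hc : c₁ t = c₂ t := tendsto_nhds_unique_of_frequently_eq
      (h₁.contMDiffAt hI ht).continuousAt (h₂.contMDiffAt hI ht).continuousAt
      (htc.mono fun s hs => congrArg Bundle.TotalSpace.proj hs.2)
    set e := chartAt (EuclideanSpace ℝ (Fin n)) (c₁ t)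
    have he : e ∈ IsManifold.maximalAtlas (𝓡 n) ∞ M := IsManifold.chart_mem_maximalAtlas _
    have hs₁ : c₁ t ∈ e.source := mem_chart_source _ _
    have hs₂ : c₂ t ∈ e.source := hc ▸ hs₁
    have hd : deriv (fun s => e (c₁ s)) t = deriv (fun s => e (c₂ s)) t := by
      refine tendsto_nhds_unique_of_frequently_eq
        (h₁.contDiffAt_deriv_comp hI he ht hs₁).continuousAt
        (h₂.contDiffAt_deriv_comp hI he ht hs₂).continuousAt ?_
      refine (htc.and_eventually ((h₁.eventually_mem_source hI ht hs₁).and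
        (h₂.eventually_mem_source hI ht hs₂))).mono ?_
      rintro s ⟨⟨hs, hvs⟩, hs₁', hs₂'⟩
      rw [h₁.velocity_eq hI he hs hs₁'.2, h₂.velocity_eq hI he hs hs₂'.2] at hvs
      exact (chartVec_injective he (e.map_source hs₁'.2) (e.map_source hs₂'.2) hvs).2
    rw [h₁.velocity_eq hI he ht hs₁, h₂.velocity_eq hI he ht hs₂, hd, hc]

end IsGeodesicOn

/-- Integral curves of the geodesic vector field in a chart project to geodesics. -/
lemma isGeodesicOn_of_hasDerivAt (he : e ∈ IsManifold.maximalAtlas (𝓡 n) ∞ M) {I : Set ℝ}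
    (hI : IsOpen I) {α : ℝ → EuclideanSpace ℝ (Fin n) × EuclideanSpace ℝ (Fin n)}
    (hα : ∀ t ∈ I, HasDerivAt α (F.geodesicField e (α t)) t) (hmem : ∀ t ∈ I, α t ∈ F.localDom e) :
    F.IsGeodesicOn (fun t => e.symm (α t).1) I
      ∧ ∀ t ∈ I, velocity (fun t => e.symm (α t).1) t = chartVec e (α t).1 (α t).2 := by
  -- The equation `α' = G(α)` with smooth `G` raises the regularity of `α` by one order at each
  -- step; order two is what a geodesic needs.
  have hbootstrap : ∀ m : ℕ, ContDiffOn ℝ m α I := by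
    intro m
    induction m with
    | zero => exact contDiffOn_zero.2 fun t ht => (hα t ht).continuousAt.continuousWithinAt
    | succ m ih =>
      refine (contDiffOn_succ_iff_deriv_of_isOpen hI).2
        ⟨fun t ht => (hα t ht).differentiableAt.differentiableWithinAt,
          fun h => absurd h (WithTop.natCast_ne_top m), ?_⟩
      refine ContDiffOn.congr (f := F.geodesicField e ∘ α) (fun t ht => ?_)
        fun t ht => (hα t ht).deriv
      exact ((contDiffAt_geodesicField he (hmem t ht)).of_le
        ENat.LEInfty.out).comp_contDiffWithinAt t (ih t ht)
  have hα2 : ∀ t ∈ I, ContDiffAt ℝ 2 α t := fun t ht =>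
    (hbootstrap 2).contDiffAt (hI.mem_nhds ht)
  have hc : ∀ t ∈ I, ContMDiffAt 𝓘(ℝ, ℝ) (𝓡 n) 2 (fun t => e.symm (α t).1) t := fun t ht =>
    ContMDiffAt.comp t ((contMDiffAt_chart_symm he (hmem t ht).1).of_le ENat.LEInfty.out)
      (contDiffAt_fst.comp t (hα2 t ht)).contMDiffAt
  have hfst : ∀ t ∈ I, HasDerivAt (fun s => (α s).1) (α t).2 t := fun t ht =>
    (hα t ht).fst
  have hvel : ∀ t ∈ I, velocity (fun t => e.symm (α t).1) t = chartVec e (α t).1 (α t).2 := by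
    intro t ht
    rw [velocity_eq_chartVec he ((hc t ht).mdifferentiableAt (by simp))
      (e.map_target (hmem t ht).1)]
    have hE : (fun s => e (e.symm (α s).1)) =ᶠ[𝓝 t] fun s => (α s).1 := by
      filter_upwards [hI.mem_nhds ht] with s hs using e.right_inv (hmem s hs).1
    rw [hE.deriv_eq, (hfst t ht).deriv, e.right_inv (hmem t ht).1]
  refine ⟨⟨fun t ht => (hc t ht).contMDiffWithinAt, fun t ht => ?_, ?_⟩, hvel⟩
  · rw [hvel t ht]
    exact (hmem t ht).2
  -- The geodesic equation has to be checked in every chart `e'`, while `α` solves it in `e`.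
  intro e' he' t ht hs i
  have hch := F.isLagrangianChange_transition he he'
  have hsrc : ∀ s ∈ I, e.symm (α s).1 ∈ e'.source → (α s).1 ∈ (e.symm.trans e').source := by
    intro s hs' hse
    rw [e.symm.trans_source]
    exact ⟨(hmem s hs').1, hse⟩
  have hev : ∀ᶠ s in 𝓝 t, s ∈ I ∧ (α s).1 ∈ (e.symm.trans e').source := by
    filter_upwards [hI.mem_nhds ht,
      (hc t ht).continuousAt.preimage_mem_nhds (e'.open_source.mem_nhds hs)] with s hs' hse
    exact ⟨hs', hsrc s hs' hse⟩
  have hlift : ∀ s ∈ I, (α s).1 ∈ (e.symm.trans e').source →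
      deriv (fun s => e' (e.symm (α s).1)) s
        = fderiv ℝ (e.symm.trans e') (α s).1 (α s).2 := by
    intro s hs' hse
    exact ((((hch.contDiffAt hse).differentiableAt (by simp)).hasFDerivAt).comp_hasDerivAt s
      (hfst s hs')).deriv
  have hx := hsrc t ht hs
  have hT := (hasFDerivAt_prolong (hch.contDiffAt hx)).differentiableAt.hasFDerivAt.comp_hasDerivAt
    t (hα t ht)
  have hT2 : HasDerivAt (fun s => ((prolong (e.symm.trans e') ∘ α) s).2)
      (fderiv ℝ (prolong (e.symm.trans e')) (α t) (F.geodesicField e (α t))).2 t := hT.snd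
  have hE : deriv (fun s => e' (e.symm (α s).1)) =ᶠ[𝓝 t]
      fun s => ((prolong (e.symm.trans e') ∘ α) s).2 := by
    filter_upwards [hev] with s hs' using hlift s hs'.1 hs'.2
  have hS := hch.spray_apply
    ((F.isSmoothLagrangian_localL he).isRegularLagrangian (F.isUnit_det_vertHessian he))
    ((F.isSmoothLagrangian_localL he').isRegularLagrangian (F.isUnit_det_vertHessian he'))
    ((F.isSmoothLagrangian_localL he).isSprayOf_sprayVec (F.isUnit_det_vertHessian he))
    ((F.isSmoothLagrangian_localL he').isSprayOf_sprayVec (F.isUnit_det_vertHessian he'))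
    (hmem t ht) hx
  -- The acceleration in `e'` is `D²φ(y, y) - Dφ S`, which the law of the spray turns into `-S'`.
  have hacc : deriv (deriv (fun s => e' (e.symm (α s).1))) t
      = -sprayVec (F.localL e') (prolong (e.symm.trans e') (α t)) := by
    rw [hE.deriv_eq, hT2.deriv, geodesicField, fderiv_prolong_apply (hch.contDiffAt hx)]
    simp only [map_neg, hS]
    abel
  rw [hacc, hlift t ht hx]
  simp [sprayVec, prolong]

/-- The weak equivalence principle holds in every Finsler space-time. -/
theorem weakEquivalencePrinciple [T2Space M] (F : FinslerSpacetime n M) :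
    F.WeakEquivalencePrinciple := by
  intro p hp t₀
  refine ⟨?_, fun c₁ c₂ a b ht₀ h₁ h₂ hv₁ hv₂ => h₁.eqOn_Ioo h₂ ht₀ (hv₁.trans hv₂.symm)⟩
  set e := chartAt (EuclideanSpace ℝ (Fin n)) p.1
  have he : e ∈ IsManifold.maximalAtlas (𝓡 n) ∞ M := IsManifold.chart_mem_maximalAtlas _
  have hs : p.1 ∈ e.source := mem_chart_source _ _
  obtain ⟨y, hy⟩ := exists_chartVec_eq he hs
  have hmem : (e p.1, y) ∈ F.localDom e := ⟨e.map_source hs, by rwa [hy]⟩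
  obtain ⟨α, hα₀, ε, hε, hα⟩ := ((contDiffAt_geodesicField he hmem).of_le (m := 1)
    ENat.LEInfty.out).exists_forall_mem_closedBall_exists_eq_forall_mem_Ioo_hasDerivAt₀ t₀
  have hcont : ContinuousAt α t₀ := (hα t₀ (by simp [hε])).continuousAt
  have hnhds := hcont.preimage_mem_nhds
    (hα₀ ▸ (F.isSmoothLagrangian_localL he).isOpen.mem_nhds hmem)
  -- Picard-Lindelöf gives a solution within `ε` of `t₀`; within `δ` it stays admissible, so both
  -- hold on the interval of radius `min ε δ`.
  obtain ⟨δ, hδ, hδU⟩ := Metric.mem_nhds_iff.1 hnhds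
  rw [Real.ball_eq_Ioo] at hδU
  have hsub₁ : Set.Ioo (t₀ - min ε δ) (t₀ + min ε δ) ⊆ Set.Ioo (t₀ - ε) (t₀ + ε) :=
    Set.Ioo_subset_Ioo (by linarith [min_le_left ε δ]) (by linarith [min_le_left ε δ])
  have hsub₂ : Set.Ioo (t₀ - min ε δ) (t₀ + min ε δ) ⊆ Set.Ioo (t₀ - δ) (t₀ + δ) :=
    Set.Ioo_subset_Ioo (by linarith [min_le_right ε δ]) (by linarith [min_le_right ε δ])
  have ht₀ : t₀ ∈ Set.Ioo (t₀ - min ε δ) (t₀ + min ε δ) := by simp [hε, hδ]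
  obtain ⟨hgeo, hvel⟩ := isGeodesicOn_of_hasDerivAt he isOpen_Ioo
    (fun t ht => hα t (hsub₁ ht)) (fun t ht => hδU (hsub₂ ht))
  refine ⟨_, _, _, ht₀, hgeo, ?_⟩
  rw [hvel t₀ ht₀, hα₀, hy]

end FinslerSpacetime

end FinslerGravity

end

theorem mainTheorem7 {n : ℕ} {M : Type*} [TopologicalSpace M] [T2Space M]
    [SecondCountableTopology M] [ChartedSpace (EuclideanSpace ℝ (Fin n)) M]
    [IsManifold (𝓡 n) ∞ M] (F : FinslerGravity.FinslerSpacetime n M)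
    (hR : F.RiemannFlat) (hP : ¬ F.NablaPVanishes) :
    ¬ F.SchiffConjecture :=
  fun h => hP (h F.weakEquivalencePrinciple).nablaPVanishes
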